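/- **Conventions.** For $C^*$-algebras $A,B$, an $A$–$B$ *correspondence* $M={}_AM_B$ is a right Hilbert $B$-module with a $*$-homomorphism $\varphi_M:A\to\mathcal L(M)$ that is nondegenerate ($\overline{\operatorname{span}}\,\varphi_M(A)M=M$). Isomorphisms of $A$–$B$ correspondences are linear bijections preserving the left action and the $B$-valued inner product. $M\otimes_BN$ denotes the balanced tensor product, with $\langle m\otimes n,m'\otimes n'\rangle=\langle n,\langle m,m'\rangle_B\cdot n'\rangle$. $M$ is *regular* if $\varphi_M$ is injective and $\varphi_M(A)\subseteq\mathcal K(M)$. For an $A$–$A$ correspondence $X$ let $J_X=\{a\in A:\varphi_X(a)\in\mathcal K(X)\text{ and }ab=0\text{ for all }b\in\ker\varphi_X\}$ (the Katsura ideal). $M$ is an *imprimitivity bimodule* if it also has an $A$-valued inner product ${}_A\langle\cdot,\cdot\rangle$ (positive definite, linear in the first variable) with ${}_A\langle am,n\rangle=a\,{}_A\langle m,n\rangle$, ${}_A\langle m,n\rangle^*={}_A\langle n,m\rangle$ and ${}_A\langle l,m\rangle n=l\langle m,n\rangle_B$, such that $\overline{\operatorname{span}}\,{}_A\langle M,M\rangle=A$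 and $\overline{\operatorname{span}}\,\langle M,M\rangle_B=B$. Correspondences ${}_AX_A$ and ${}_BY_B$ are *Morita equivalent* if there is an $A$–$B$ imprimitivity bimodule $M$ with $X\otimes_AM\cong M\otimes_BY$ as $A$–$B$ correspondences. **The category $\mathsf{ECCor}$.** Objects are pairs $(A,X)$ of a $C^*$-algebra $A$ and an $A$–$A$ correspondence $X$. A morphism ${}_AX_A\to{}_BY_B$ is the isomorphism class $[{}_AM_B,U_M]$ of a pair consisting of a regular $A$–$B$ correspondence $M$ with $J_X\cdot M\subseteq M\cdot J_Y$ and an isomorphism $U_M:X\otimes_AM\to M\otimes_BY$; here $(M,U_M)$ and $(N,U_N)$ are isomorphic if there is an isomorphism $\xi:M\to N$ with $(\xi\otimes1_Y)U_M=U_N(1_X\otimes\xi)$. Composition is $[N,U_N]\circ[M,U_M]=[M\otimes_BN,(1_M\otimes U_N)(U_M\otimes1_N)]$, and the identity of ${}_AX_A$ is $[{}_AA_A,U_A]$ with $U_A:X\otimes_AA\cong X\cong A\otimes_AX$ the canonical isomorphism. **Proposition.** 1. A morphism $[{}_AM_B,U_M]:{}_AX_A\to{}_BY_B$ in $\mathsf{ECCor}$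 is an isomorphism if and only if ${}_AM_B$ is an imprimitivity bimodule. 2. Consequently, ${}_AX_A$ and ${}_BY_B$ are isomorphic in $\mathsf{ECCor}$ if and only if they are Morita equivalent. -/

import Mathlib

open scoped TensorProduct

universe u

namespace CStarCorr

attribute [local instance] CStarAlgebra.spectralOrder CStarAlgebra.spectralOrderedRing

variable {A B C D : Type u} [NonUnitalCStarAlgebra A] [NonUnitalCStarAlgebra B]
  [NonUnitalCStarAlgebra C] [NonUnitalCStarAlgebra D]

/-- The negative part of a self-adjoint element, packaged without functional calculus. -/
theorem exists_negPart {E : Type*} [NonUnitalCStarAlgebra E] (M : E) (hM : IsSelfAdjoint M) :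
    ∃ m R : E, star m = m ∧ m * M * m = -(star R * R) ∧ (R = 0 → ∃ S, M = star S * S) := by
  obtain ⟨m, hm⟩ : ∃ m, m = M⁻ := ⟨_, rfl⟩
  have hm0 : 0 ≤ m := hm ▸ CFC.negPart_nonneg M
  have hs : star m = m := hm0.isSelfAdjoint
  have h2 : 0 ≤ m * m * m := by
    have := hm0.isSelfAdjoint.conjugate_nonneg hm0
    simpa using this
  have hMe : M⁺ - m = M := hm ▸ CFC.posPart_sub_negPart M hM
  have hmp : m * M⁺ = 0 := hm ▸ CFC.negPart_mul_posPart M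
  obtain ⟨R, hR⟩ := CStarAlgebra.nonneg_iff_eq_star_mul_self.1 h2
  refine ⟨m, R, hs, ?_, fun hR0 => ?_⟩
  · have : m * M * m = m * (M⁺ - m) * m := by rw [hMe]
    rw [this, mul_sub, sub_mul, hmp, ← hR]
    simp
  · rw [hR0] at hR
    have h7 : star (m * m) * (m * m) = 0 := by
      rw [star_mul, hs, ← mul_assoc, hR]
      simp
    have h8 := (CStarRing.star_mul_self_eq_zero_iff _).1 h7
    have h9 : star m * m = 0 := by rw [hs, h8]
    have h10 : m = 0 := (CStarRing.star_mul_self_eq_zero_iff _).1 h9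
    refine CStarAlgebra.nonneg_iff_eq_star_mul_self.1 ?_
    rw [← hMe, h10, sub_zero]
    exact CFC.posPart_nonneg M

/-- Positivity of a matrix over a C*-algebra can be tested on columns. -/
theorem exists_factor {ι : Type*} [Fintype ι] [DecidableEq ι] (T : ι → ι → A) (hT : ∀ i j, star (T i j) = T j i)
    (h : ∀ a : ι → A, 0 ≤ ∑ i, ∑ j, star (a i) * T i j * a j) :
    ∃ S : ι → ι → A, ∀ i j, T i j = ∑ k, star (S k i) * S k j := by
  let M : CStarMatrix ι ι A := CStarMatrix.ofMatrix (Matrix.of T)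
  have hM : IsSelfAdjoint M := by
    ext i j
    exact hT j i
  have hsum0 : ∀ (c : ι → A), (∑ i, star (c i) * c i ≤ 0) → ∀ i, c i = 0 := by
    intro c hc i
    have h0 := Finset.sum_eq_zero_iff_of_nonneg (fun i _ => star_mul_self_nonneg (c i)) |>.1
      (le_antisymm hc (Finset.sum_nonneg fun i _ => star_mul_self_nonneg (c i))) i
      (Finset.mem_univ i)
    exact (CStarRing.star_mul_self_eq_zero_iff _).1 h0
  obtain ⟨m, R, hs, h1, h2⟩ := exists_negPart M hM
  have hR0 : R = 0 := by
    ext k l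
    refine hsum0 (fun i => R i l) ?_ k
    have h3 : ∑ i, star (R i l) * R i l = (star R * R) l l := rfl
    have h4 : (m * M * m) l l = ∑ i, ∑ j, star (m i l) * T i j * m j l := by
      have : (m * M * m) l l = ∑ j, (∑ i, m l i * T i j) * m j l := rfl
      rw [this, Finset.sum_comm]
      refine Finset.sum_congr rfl fun j _ => ?_
      rw [Finset.sum_mul]
      refine Finset.sum_congr rfl fun i _ => ?_
      congr 2
      exact (congrFun (congrFun hs l) i).symm
    rw [h3]
    have h5 := h (fun i => m i l)
    rw [← h4, h1] at h5
    have h6 : (-(star R * R)) l l = - ((star R * R) l l) := rfl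
    rw [h6] at h5
    exact neg_nonneg.1 h5
  obtain ⟨S, hS⟩ := h2 hR0
  refine ⟨fun i j => S i j, fun i j => ?_⟩
  exact congrFun (congrFun hS i) j

/-- A pre-correspondence: a complex vector space with a `B`-valued semi-inner product,
a left action of `A` by adjointable operators, and a right action of `B`. -/
structure Pre (A B : Type u) [NonUnitalCStarAlgebra A] [NonUnitalCStarAlgebra B] :
    Type (u + 1) where
  V : Type u
  [acg : AddCommGroup V]
  [mod : Module ℂ V]
  ip : V →ₗ⋆[ℂ] V →ₗ[ℂ] B
  l : A → V →ₗ[ℂ] V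
  r : B → V →ₗ[ℂ] V
  star_ip : ∀ x y, star (ip x y) = ip y x
  ip_nonneg : ∀ x, 0 ≤ ip x x
  ip_r : ∀ x y b, ip x (r b y) = ip x y * b
  l_add : ∀ a b x, l (a + b) x = l a x + l b x
  l_smul : ∀ (c : ℂ) a x, l (c • a) x = c • l a x
  l_mul : ∀ a b x, l (a * b) x = l a (l b x)
  ip_l : ∀ a x y, ip (l a x) y = ip x (l (star a) y)

namespace Pre

attribute [instance] Pre.acg Pre.mod

variable (P : Pre A B)

theorem ip_r_left (x y : P.V) (b : B) : P.ip (P.r b x) y = star b * P.ip x y := by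
  rw [← P.star_ip, P.ip_r, star_mul, P.star_ip]

theorem ip_smul_left (c : ℂ) (x y : P.V) : P.ip (c • x) y = star c • P.ip x y := by
  rw [LinearMap.map_smulₛₗ P.ip c x, LinearMap.smul_apply, starRingEnd_apply]

theorem ip_smul_right (c : ℂ) (x y : P.V) : P.ip x (c • y) = c • P.ip x y :=
  map_smul (P.ip x) c y

theorem star_mul_ip_le (x y : P.V) (t : ℝ) (ht : ‖P.ip x x‖ ≤ t) (ht0 : 0 < t) :
    star (P.ip x y) * P.ip x y ≤ t • P.ip y y := by
  set c := P.ip x y with hc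
  have h0 := P.ip_nonneg (P.r c x - (t : ℂ) • y)
  have hyx : P.ip y x = star c := (P.star_ip x y).symm
  have e : P.ip (P.r c x - (t : ℂ) • y) (P.r c x - (t : ℂ) • y)
      = star c * P.ip x x * c - t • (star c * c) - t • (star c * c) + t • t • P.ip y y := by
    rw [map_sub, map_sub, LinearMap.sub_apply, LinearMap.sub_apply, P.ip_smul_left,
      P.ip_smul_left, P.ip_smul_right, P.ip_smul_right, ← starRingEnd_apply, Complex.conj_ofReal,
      P.ip_r, P.ip_r_left, P.ip_r, P.ip_r_left, hyx, ← hc]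
    simp only [Complex.coe_smul]
    module
  have h1 : star c * P.ip x x * c ≤ t • (star c * c) := by
    refine (CStarAlgebra.star_left_conjugate_le_norm_smul (a := c) (b := P.ip x x)
      (hb := (P.ip_nonneg x).isSelfAdjoint)).trans ?_
    exact smul_le_smul_of_nonneg_right ht (star_mul_self_nonneg c)
  rw [e] at h0
  have h2 : 0 ≤ t • (t • P.ip y y - star c * c) := by
    calc 0 ≤ _ := h0
      _ ≤ t • (star c * c) - t • (star c * c) - t • (star c * c) + t • t • P.ip y y := by gcongr
      _ = _ := by module
  have h3 := smul_nonneg (inv_nonneg.2 ht0.le) h2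
  rw [smul_smul, inv_mul_cancel₀ ht0.ne', one_smul] at h3
  exact sub_nonneg.1 h3

theorem norm_ip_sq_le (x y : P.V) : ‖P.ip x y‖ ^ 2 ≤ ‖P.ip x x‖ * ‖P.ip y y‖ := by
  refine le_of_forall_pos_le_add fun ε hε => ?_
  have key : ∀ t : ℝ, ‖P.ip x x‖ ≤ t → 0 < t → ‖P.ip x y‖ ^ 2 ≤ t * ‖P.ip y y‖ := by
    intro t ht ht0
    have := CStarAlgebra.norm_le_norm_of_nonneg_of_le (star_mul_self_nonneg _)
      (P.star_mul_ip_le x y t ht ht0)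
    rw [CStarRing.norm_star_mul_self, norm_smul, Real.norm_of_nonneg ht0.le] at this
    rwa [sq]
  have hp : 0 < ‖P.ip y y‖ + 1 := by positivity
  have := key (‖P.ip x x‖ + ε / (‖P.ip y y‖ + 1)) (by have := div_pos hε hp; linarith)
    (by have := div_pos hε hp; have := norm_nonneg (P.ip x x); linarith)
  refine this.trans ?_
  rw [add_mul]
  gcongr
  rw [div_mul_eq_mul_div, div_le_iff₀ hp]
  nlinarith [norm_nonneg (P.ip y y)]

noncomputable def nrm (x : P.V) : ℝ := √‖P.ip x x‖

theorem nrm_sq (x : P.V) : P.nrm x ^ 2 = ‖P.ip x x‖ := Real.sq_sqrt (norm_nonneg _)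

theorem nrm_nonneg (x : P.V) : 0 ≤ P.nrm x := Real.sqrt_nonneg _

theorem norm_ip_le (x y : P.V) : ‖P.ip x y‖ ≤ P.nrm x * P.nrm y := by
  refine abs_le_of_sq_le_sq' ?_ (mul_nonneg (P.nrm_nonneg x) (P.nrm_nonneg y)) |>.2
  rw [mul_pow, P.nrm_sq, P.nrm_sq]
  exact P.norm_ip_sq_le x y

theorem norm_core : letI : Norm P.V := ⟨P.nrm⟩; SeminormedSpace.Core ℂ P.V :=
  letI : Norm P.V := ⟨P.nrm⟩
  { norm_nonneg := P.nrm_nonneg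
    norm_smul := fun c x => by
      change P.nrm _ = _ * P.nrm _
      refine (sq_eq_sq₀ (P.nrm_nonneg _) (mul_nonneg (norm_nonneg _) (P.nrm_nonneg _))).1 ?_
      rw [mul_pow, P.nrm_sq, P.nrm_sq]
      simp only [LinearMap.map_smulₛₗ, map_smul, LinearMap.smul_apply, norm_smul]
      simp; ring
    norm_triangle := fun x y => by
      change P.nrm _ ≤ P.nrm _ + P.nrm _
      refine abs_le_of_sq_le_sq' ?_ (add_nonneg (P.nrm_nonneg x) (P.nrm_nonneg y)) |>.2
      rw [P.nrm_sq]
      have e : P.ip (x + y) (x + y) = P.ip x x + P.ip x y + (P.ip y x + P.ip y y) := by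
        simp only [map_add, LinearMap.add_apply]; abel
      calc _ ≤ ‖P.ip x x‖ + ‖P.ip x y‖ + (‖P.ip y x‖ + ‖P.ip y y‖) := by
            rw [e]
            exact (norm_add_le _ _).trans (add_le_add (norm_add_le _ _) (norm_add_le _ _))
        _ ≤ P.nrm x ^ 2 + P.nrm x * P.nrm y + (P.nrm y * P.nrm x + P.nrm y ^ 2) := by
            rw [P.nrm_sq, P.nrm_sq]
            gcongr <;> exact P.norm_ip_le _ _
        _ = _ := by ring }

noncomputable instance : SeminormedAddCommGroup P.V :=
  letI : Norm P.V := ⟨P.nrm⟩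
  SeminormedAddCommGroup.ofCore P.norm_core

theorem norm_def (x : P.V) : ‖x‖ = P.nrm x := rfl

noncomputable instance : NormedSpace ℂ P.V where
  norm_smul_le c x :=
    letI : Norm P.V := ⟨P.nrm⟩
    (P.norm_core.norm_smul c x).le

theorem norm_r_le (b : B) (x : P.V) : ‖P.r b x‖ ≤ ‖b‖ * ‖x‖ := by
  rw [P.norm_def, P.norm_def]
  refine abs_le_of_sq_le_sq' ?_ (mul_nonneg (norm_nonneg b) (P.nrm_nonneg x)) |>.2
  rw [mul_pow, P.nrm_sq, P.nrm_sq, P.ip_r, P.ip_r_left]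
  refine (norm_mul_le _ _).trans ?_
  refine (mul_le_mul_of_nonneg_right (norm_mul_le _ _) (norm_nonneg _)).trans ?_
  rw [norm_star]
  exact le_of_eq (by ring)

theorem ip_l_le (a : A) (x : P.V) : P.ip (P.l a x) (P.l a x) ≤ (‖a‖ ^ 2) • P.ip x x := by
  let U := Unitization ℂ A
  have h1 : (0 : U) ≤ algebraMap ℝ U (‖a‖ ^ 2) - star (a : U) * (a : U) := by
    rw [sub_nonneg]
    have := CStarAlgebra.star_mul_le_algebraMap_norm_sq (a := (a : U))
    rwa [Unitization.norm_inr] at this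
  obtain ⟨s, hs⟩ := CStarAlgebra.nonneg_iff_eq_star_mul_self.1 h1
  have hf : star s.fst * s.fst = ((‖a‖ ^ 2 : ℝ) : ℂ) := by
    have := congrArg (fun z : Unitization ℂ A => z.fst) hs
    simp [U, Unitization.algebraMap_eq_inl_comp, sub_eq_add_neg] at this
    simpa using this.symm
  have hg : star s.fst • s.snd + s.fst • star s.snd + star s.snd * s.snd = - (star a * a) := by
    have := congrArg (fun z : Unitization ℂ A => z.snd) hs
    simp [U, Unitization.algebraMap_eq_inl_comp, sub_eq_add_neg] at this
    simpa using this.symm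
  have h2 := P.ip_nonneg (s.fst • x + P.l s.snd x)
  have e : P.ip (s.fst • x + P.l s.snd x) (s.fst • x + P.l s.snd x)
      = (‖a‖ ^ 2) • P.ip x x - P.ip (P.l a x) (P.l a x) := by
    have h3 : P.ip x (P.l (star s.fst • s.snd + s.fst • star s.snd + star s.snd * s.snd) x)
        = P.ip x (P.l (- (star a * a)) x) := by rw [hg]
    have h4 : P.l (- (star a * a)) x = - P.l (star a * a) x := by
      rw [← neg_one_smul ℂ, P.l_smul, neg_one_smul]
    rw [h4] at h3
    simp only [P.l_add, P.l_smul, P.l_mul, map_add, map_neg, map_smul] at h3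
    have h5 : ((‖a‖ ^ 2) : ℝ) • P.ip x x = (star s.fst * s.fst) • P.ip x x := by
      rw [hf, Complex.coe_smul]
    rw [h5, P.ip_l a x, sub_eq_add_neg, ← h3]
    simp only [map_add, LinearMap.add_apply, map_smul, LinearMap.map_smulₛₗ, LinearMap.smul_apply,
      P.ip_l, starRingEnd_apply]
    module
  rw [e] at h2
  exact sub_nonneg.1 h2

theorem norm_l_le (a : A) (x : P.V) : ‖P.l a x‖ ≤ ‖a‖ * ‖x‖ := by
  rw [P.norm_def, P.norm_def]
  refine abs_le_of_sq_le_sq' ?_ (mul_nonneg (norm_nonneg a) (P.nrm_nonneg x)) |>.2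
  rw [mul_pow, P.nrm_sq, P.nrm_sq]
  refine (CStarAlgebra.norm_le_norm_of_nonneg_of_le (P.ip_nonneg _) (P.ip_l_le a x)).trans ?_
  rw [norm_smul, Real.norm_of_nonneg (by positivity)]


theorem l_zero (x : P.V) : P.l 0 x = 0 := by
  have := P.l_smul 0 0 x
  simpa using this

theorem l_sum {ι : Type*} (s : Finset ι) (f : ι → A) (x : P.V) :
    P.l (∑ i ∈ s, f i) x = ∑ i ∈ s, P.l (f i) x := by
  classical
  induction s using Finset.induction_on with
  | empty => simpa using P.l_zero x
  | insert i s hi ih => rw [Finset.sum_insert hi, Finset.sum_insert hi, P.l_add, ih]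

section tensor

variable (Q : Pre B C)

/-- The semi-inner product on the algebraic tensor product, determined by
`⟪x ⊗ y, u ⊗ v⟫ = ⟪y, ⟪x, u⟫ v⟫`. -/
noncomputable def tensorIp : (P.V ⊗[ℂ] Q.V) →ₗ⋆[ℂ] (P.V ⊗[ℂ] Q.V) →ₗ[ℂ] C :=
  TensorProduct.lift <| LinearMap.mk₂'ₛₗ (starRingEnd ℂ) (starRingEnd ℂ)
    (fun x y => TensorProduct.lift <| LinearMap.mk₂ ℂ (fun u v => Q.ip y (Q.l (P.ip x u) v))
      (fun u u' v => by rw [map_add, Q.l_add, map_add])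
      (fun c u v => by rw [map_smul, Q.l_smul, map_smul])
      (fun u v v' => by rw [map_add, map_add])
      (fun c u v => by rw [map_smul, map_smul]))
    (fun x x' y => by
      ext u v
      simp [Q.l_add])
    (fun c x y => by
      ext u v
      simp [Q.l_smul])
    (fun x y y' => by
      ext u v
      simp)
    (fun c x y => by
      ext u v
      simp)

@[simp]
theorem tensorIp_tmul (x u : P.V) (y v : Q.V) :
    P.tensorIp Q (x ⊗ₜ y) (u ⊗ₜ v) = Q.ip y (Q.l (P.ip x u) v) := rfl

theorem tensorIp_star (z w : P.V ⊗[ℂ] Q.V) :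
    star (P.tensorIp Q z w) = P.tensorIp Q w z := by
  induction z with
  | zero => simp
  | add z z' hz hz' => simp [hz, hz']
  | tmul x y =>
    induction w with
    | zero => simp
    | add w w' hw hw' => simp [hw, hw']
    | tmul u v => rw [tensorIp_tmul, tensorIp_tmul, Q.star_ip, Q.ip_l, P.star_ip]

theorem tensorIp_nonneg (z : P.V ⊗[ℂ] Q.V) : 0 ≤ P.tensorIp Q z z := by
  classical
  obtain ⟨S, rfl⟩ := TensorProduct.exists_finset z
  rw [← Finset.sum_coe_sort S (fun i => i.1 ⊗ₜ[ℂ] i.2)]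
  obtain ⟨T, hT⟩ := exists_factor (fun i j : S => P.ip i.1.1 j.1.1)
    (fun i j => P.star_ip _ _) (fun a => by
      have h := P.ip_nonneg (∑ i : S, P.r (a i) i.1.1)
      simp only [map_sum, LinearMap.sum_apply, P.ip_r, P.ip_r_left] at h
      rwa [Finset.sum_comm] at h)
  have e : P.tensorIp Q (∑ i : S, i.1.1 ⊗ₜ[ℂ] i.1.2) (∑ i : S, i.1.1 ⊗ₜ[ℂ] i.1.2)
      = ∑ k : S, Q.ip (∑ i : S, Q.l (T k i) i.1.2) (∑ i : S, Q.l (T k i) i.1.2) := by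
    simp only [map_sum, LinearMap.sum_apply, tensorIp_tmul, hT, Q.l_sum, Q.ip_l, Q.l_mul]
    conv_rhs => rw [Finset.sum_comm]
    refine Finset.sum_congr rfl fun i _ => ?_
    rw [Finset.sum_comm]
  rw [e]
  exact Finset.sum_nonneg fun k _ => Q.ip_nonneg _

/-- The algebraic tensor product of two pre-correspondences, as a pre-correspondence. -/
@[simps V ip]
noncomputable def tensor : Pre A C where
  V := P.V ⊗[ℂ] Q.V
  ip := P.tensorIp Q
  l a := LinearMap.rTensor Q.V (P.l a)
  r c := LinearMap.lTensor P.V (Q.r c)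
  star_ip := P.tensorIp_star Q
  ip_nonneg := P.tensorIp_nonneg Q
  ip_r z w c := by
    induction z with
    | zero => simp
    | add z z' hz hz' => rw [map_add, LinearMap.add_apply, LinearMap.add_apply, hz, hz', add_mul]
    | tmul x y =>
      induction w with
      | zero => simp
      | add w w' hw hw' => rw [map_add, map_add, map_add, hw, hw', add_mul]
      | tmul u v =>
        rw [LinearMap.lTensor_tmul, tensorIp_tmul, tensorIp_tmul, ← Q.star_ip, Q.ip_l,
          Q.ip_r_left, star_mul, star_star, ← Q.ip_l, Q.star_ip]
  l_add a b z := by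
    induction z with
    | zero => simp
    | add z z' hz hz' => rw [map_add, map_add, map_add, hz, hz']; abel
    | tmul x y => simp [P.l_add, TensorProduct.add_tmul]
  l_smul c a z := by
    induction z with
    | zero => simp
    | add z z' hz hz' => rw [map_add, map_add, hz, hz', smul_add]
    | tmul x y => simp [P.l_smul, TensorProduct.smul_tmul']
  l_mul a b z := by
    induction z with
    | zero => simp
    | add z z' hz hz' => rw [map_add, map_add, map_add, hz, hz']
    | tmul x y => simp [P.l_mul]
  ip_l a z w := by
    induction z with
    | zero => simp
    | add z z' hz hz' =>
      rw [map_add, map_add, map_add, LinearMap.add_apply, LinearMap.add_apply, hz, hz']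
    | tmul x y =>
      induction w with
      | zero => simp
      | add w w' hw hw' => rw [map_add, map_add, map_add, hw, hw']
      | tmul u v => simp [P.ip_l]

end tensor

end Pre

/-- A (right) Hilbert `B`-module: a complex Banach space with a right action `x · b` of `B` and a
`B`-valued inner product, linear in the second variable, whose norm is `‖x‖ = ‖⟪x, x⟫‖ ^ (1/2)`.
(Mathlib's `CStarModule` is modelled on left actions.  Bilinearity and associativity of the right
action follow from the listed identities, see `rsmul_add`, `add_rsmul`, `smul_rsmul`,
`rsmul_smul`, `rsmul_rsmul`.) -/
structure HilbertModule (B : Type u) [NonUnitalCStarAlgebra B] : Type (u + 1) where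
  carrier : Type u
  [normedAddCommGroup : NormedAddCommGroup carrier]
  [normedSpace : NormedSpace ℂ carrier]
  [completeSpace : CompleteSpace carrier]
  rsmul : carrier → B → carrier
  inner : carrier → carrier → B
  inner_add_right : ∀ x y z, inner x (y + z) = inner x y + inner x z
  inner_smul_right : ∀ (c : ℂ) x y, inner x (c • y) = c • inner x y
  inner_rsmul_right : ∀ x y b, inner x (rsmul y b) = inner x y * b
  star_inner : ∀ x y, star (inner x y) = inner y x
  inner_self_nonneg : ∀ x, 0 ≤ inner x x
  norm_sq_eq : ∀ x, ‖x‖ ^ 2 = ‖inner x x‖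

namespace HilbertModule

attribute [instance] HilbertModule.normedAddCommGroup HilbertModule.normedSpace
  HilbertModule.completeSpace

variable (X : HilbertModule B)

theorem inner_add_left (x y z : X.carrier) : X.inner (x + y) z = X.inner x z + X.inner y z := by
  rw [← X.star_inner, X.inner_add_right, star_add, X.star_inner, X.star_inner]

theorem inner_smul_left (c : ℂ) (x y : X.carrier) :
    X.inner (c • x) y = star c • X.inner x y := by
  rw [← X.star_inner, X.inner_smul_right, star_smul, X.star_inner]

theorem inner_rsmul_left (x y : X.carrier) (b : B) :
    X.inner (X.rsmul x b) y = star b * X.inner x y := by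
  rw [← X.star_inner, X.inner_rsmul_right, star_mul, X.star_inner]

theorem ext_inner {x y : X.carrier} (h : ∀ z, X.inner z x = X.inner z y) : x = y := by
  have h1 : X.inner (x - y) (x - y) = 0 := by
    rw [sub_eq_add_neg x y, X.inner_add_right, ← neg_one_smul ℂ y, X.inner_smul_right, h]
    simp
  have h2 := X.norm_sq_eq (x - y)
  rw [h1, norm_zero] at h2
  exact sub_eq_zero.1 (norm_eq_zero.1 (pow_eq_zero_iff two_ne_zero |>.1 h2))

theorem rsmul_add (x : X.carrier) (b c : B) : X.rsmul x (b + c) = X.rsmul x b + X.rsmul x c :=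
  X.ext_inner fun z => by simp only [X.inner_rsmul_right, X.inner_add_right, mul_add]

theorem add_rsmul (x y : X.carrier) (b : B) : X.rsmul (x + y) b = X.rsmul x b + X.rsmul y b :=
  X.ext_inner fun z => by simp only [X.inner_rsmul_right, X.inner_add_right, add_mul]

theorem smul_rsmul (c : ℂ) (x : X.carrier) (b : B) : X.rsmul (c • x) b = c • X.rsmul x b :=
  X.ext_inner fun z => by simp only [X.inner_rsmul_right, X.inner_smul_right, smul_mul_assoc]

theorem rsmul_smul (c : ℂ) (x : X.carrier) (b : B) : X.rsmul x (c • b) = c • X.rsmul x b :=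
  X.ext_inner fun z => by simp only [X.inner_rsmul_right, X.inner_smul_right, mul_smul_comm]

theorem rsmul_rsmul (x : X.carrier) (b c : B) : X.rsmul (X.rsmul x b) c = X.rsmul x (b * c) :=
  X.ext_inner fun z => by simp only [X.inner_rsmul_right, mul_assoc]

end HilbertModule

/-- A nondegenerate C*-correspondence from `A` to `B`: a right Hilbert `B`-module `X` with a
*-homomorphism from `A` to the adjointable operators on `X`, `a ↦ (x ↦ a · x)`, such that
`A · X` spans a dense subspace.  The identity `⟪a · x, y⟫ = ⟪x, a* · y⟫` says that `a` acts by an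
adjointable operator, with adjoint the action of `a*`. -/
structure Corr (A B : Type u) [NonUnitalCStarAlgebra A] [NonUnitalCStarAlgebra B] :
    Type (u + 1) extends HilbertModule B where
  lsmul : A → carrier → carrier
  add_lsmul : ∀ a b x, lsmul (a + b) x = lsmul a x + lsmul b x
  smul_lsmul : ∀ (c : ℂ) a x, lsmul (c • a) x = c • lsmul a x
  mul_lsmul : ∀ a b x, lsmul (a * b) x = lsmul a (lsmul b x)
  inner_lsmul_left : ∀ a x y, inner (lsmul a x) y = inner x (lsmul (star a) y)
  nondegenerate : Dense (Submodule.span ℂ {z | ∃ a x, lsmul a x = z} : Set carrier)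

namespace Corr

variable (X : Corr A B)

theorem inner_lsmul_right (a : A) (x y : X.carrier) :
    X.inner x (X.lsmul a y) = X.inner (X.lsmul (star a) x) y := by
  rw [X.inner_lsmul_left, star_star]

theorem lsmul_add (a : A) (x y : X.carrier) : X.lsmul a (x + y) = X.lsmul a x + X.lsmul a y :=
  X.ext_inner fun z => by simp only [X.inner_lsmul_right, X.inner_add_right]

theorem lsmul_smul (a : A) (c : ℂ) (x : X.carrier) : X.lsmul a (c • x) = c • X.lsmul a x :=
  X.ext_inner fun z => by simp only [X.inner_lsmul_right, X.inner_smul_right]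

/-- The pre-correspondence underlying a correspondence. -/
@[simps V]
def toPre : Pre A B where
  V := X.carrier
  ip := LinearMap.mk₂'ₛₗ (starRingEnd ℂ) (RingHom.id ℂ) X.inner
    X.inner_add_left X.inner_smul_left X.inner_add_right X.inner_smul_right
  l a := ⟨⟨X.lsmul a, X.lsmul_add a⟩, X.lsmul_smul a⟩
  r b := ⟨⟨fun x => X.rsmul x b, fun x y => X.add_rsmul x y b⟩, fun c x => X.smul_rsmul c x b⟩
  star_ip := X.star_inner
  ip_nonneg := X.inner_self_nonneg
  ip_r := X.inner_rsmul_right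
  l_add := X.add_lsmul
  l_smul := X.smul_lsmul
  l_mul := X.mul_lsmul
  ip_l := X.inner_lsmul_left

theorem toPre_nrm (x : X.carrier) : X.toPre.nrm x = ‖x‖ := by
  change √‖X.inner x x‖ = _
  rw [← X.norm_sq_eq, Real.sqrt_sq (norm_nonneg x)]

theorem norm_inner_le (x y : X.carrier) : ‖X.inner x y‖ ≤ ‖x‖ * ‖y‖ := by
  rw [← X.toPre_nrm, ← X.toPre_nrm]
  exact X.toPre.norm_ip_le x y

theorem norm_lsmul_le (a : A) (x : X.carrier) : ‖X.lsmul a x‖ ≤ ‖a‖ * ‖x‖ := by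
  rw [← X.toPre_nrm, ← X.toPre_nrm]
  exact X.toPre.norm_l_le a x

theorem norm_rsmul_le (x : X.carrier) (b : B) : ‖X.rsmul x b‖ ≤ ‖x‖ * ‖b‖ := by
  rw [← X.toPre_nrm, ← X.toPre_nrm, mul_comm]
  exact X.toPre.norm_r_le b x

/-- The homomorphism `φ_X` from `A` into the bounded operators on `X`. -/
noncomputable def φ (a : A) : X.carrier →L[ℂ] X.carrier :=
  LinearMap.mkContinuous (X.toPre.l a) ‖a‖ (X.norm_lsmul_le a)

@[simp] theorem φ_apply (a : A) (x : X.carrier) : X.φ a x = X.lsmul a x := rfl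

/-- Right multiplication by `b`, as a bounded operator. -/
noncomputable def ρ (b : B) : X.carrier →L[ℂ] X.carrier :=
  LinearMap.mkContinuous (X.toPre.r b) ‖b‖ (fun x => (X.norm_rsmul_le x b).trans (mul_comm _ _).le)

@[simp] theorem ρ_apply (b : B) (x : X.carrier) : X.ρ b x = X.rsmul x b := rfl

/-- The `B`-valued inner product, as a bounded sesquilinear map. -/
noncomputable def innerL : X.carrier →L⋆[ℂ] X.carrier →L[ℂ] B :=
  LinearMap.mkContinuous₂ X.toPre.ip 1 (fun x y => by rw [one_mul]; exact X.norm_inner_le x y)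

@[simp] theorem innerL_apply (x y : X.carrier) : X.innerL x y = X.inner x y := rfl

theorem continuous_inner {α : Type*} [TopologicalSpace α] {f g : α → X.carrier}
    (hf : Continuous f) (hg : Continuous g) : Continuous fun x => X.inner (f x) (g x) :=
  (X.innerL.continuous.comp hf).clm_apply hg

theorem continuous_lsmul {α : Type*} [TopologicalSpace α] {f : α → X.carrier}
    (hf : Continuous f) (a : A) : Continuous fun x => X.lsmul a (f x) :=
  (X.φ a).continuous.comp hf

theorem continuous_rsmul {α : Type*} [TopologicalSpace α] {f : α → X.carrier}
    (hf : Continuous f) (b : B) : Continuous fun x => X.rsmul (f x) b :=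
  (X.ρ b).continuous.comp hf

end Corr

namespace Pre

open UniformSpace

variable (P : Pre A B)

/-- The extension of the semi-inner product to the Hausdorff completion. -/
noncomputable def innerC (x y : Completion P.V) : B :=
  ((Completion.isDenseInducing_coe (α := P.V)).prodMap
    (Completion.isDenseInducing_coe (α := P.V))).extend (fun p : P.V × P.V => P.ip p.1 p.2) (x, y)

theorem continuous_ip : Continuous fun p : P.V × P.V => P.ip p.1 p.2 :=
  (((LinearMap.mkContinuous₂ P.ip 1
    (fun x y => by rw [one_mul]; exact P.norm_ip_le x y)).continuous.comp
      continuous_fst).clm_apply continuous_snd)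

@[simp]
theorem innerC_coe (x y : P.V) : P.innerC (x : Completion P.V) (y : Completion P.V) = P.ip x y :=
  ((Completion.isDenseInducing_coe (α := P.V)).prodMap
    (Completion.isDenseInducing_coe (α := P.V))).extend_eq P.continuous_ip (x, y)

theorem continuous_innerC : Continuous fun p : Completion P.V × Completion P.V =>
    P.innerC p.1 p.2 := by
  let inner' : P.V →+ P.V →+ B :=
    { toFun := fun x => (P.ip x).toAddMonoidHom
      map_zero' := by ext x; simp
      map_add' := fun x y => by ext z; simp }
  have h : Continuous fun p : P.V × P.V => inner' p.1 p.2 := P.continuous_ip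
  exact (Completion.isDenseInducing_toCompl P.V).extend_Z_bilin
    (Completion.isDenseInducing_toCompl P.V) h

theorem cont_innerC {α : Type*} [TopologicalSpace α] {f g : α → Completion P.V}
    (hf : Continuous f) (hg : Continuous g) : Continuous fun x => P.innerC (f x) (g x) :=
  P.continuous_innerC.comp (hf.prodMk hg)

/-- The left action on the completion. -/
noncomputable def lC (a : A) : Completion P.V → Completion P.V := Completion.map (P.l a)

/-- The right action on the completion. -/
noncomputable def rC (b : B) : Completion P.V → Completion P.V := Completion.map (P.r b)

theorem uc_l (a : A) : UniformContinuous (P.l a) :=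
  (LinearMap.mkContinuous (P.l a) ‖a‖ (P.norm_l_le a)).uniformContinuous

theorem uc_r (b : B) : UniformContinuous (P.r b) :=
  (LinearMap.mkContinuous (P.r b) ‖b‖ (P.norm_r_le b)).uniformContinuous

@[simp] theorem lC_coe (a : A) (x : P.V) : P.lC a (x : Completion P.V) = (P.l a x : P.V) :=
  Completion.map_coe (P.uc_l a) x

@[simp] theorem rC_coe (b : B) (x : P.V) : P.rC b (x : Completion P.V) = (P.r b x : P.V) :=
  Completion.map_coe (P.uc_r b) x

theorem cont_lC (a : A) {α : Type*} [TopologicalSpace α] {f : α → Completion P.V}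
    (hf : Continuous f) : Continuous fun x => P.lC a (f x) := Completion.continuous_map.comp hf

theorem cont_rC (b : B) {α : Type*} [TopologicalSpace α] {f : α → Completion P.V}
    (hf : Continuous f) : Continuous fun x => P.rC b (f x) := Completion.continuous_map.comp hf

theorem innerC_add (x y z : Completion P.V) :
    P.innerC x (y + z) = P.innerC x y + P.innerC x z := by
  refine Completion.induction_on₃ x y z ?_ fun x y z => ?_
  · exact isClosed_eq
      (P.cont_innerC continuous_fst (continuous_snd.fst.add continuous_snd.snd))
      ((P.cont_innerC continuous_fst continuous_snd.fst).add
        (P.cont_innerC continuous_fst continuous_snd.snd))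
  · rw [← Completion.coe_add, innerC_coe, innerC_coe, innerC_coe, map_add]

theorem innerC_smul (c : ℂ) (x y : Completion P.V) :
    P.innerC x (c • y) = c • P.innerC x y := by
  refine Completion.induction_on₂ x y ?_ fun x y => ?_
  · exact isClosed_eq
      (P.cont_innerC continuous_fst (continuous_snd.const_smul c))
      ((P.cont_innerC continuous_fst continuous_snd).const_smul c)
  · rw [← Completion.coe_smul, innerC_coe, innerC_coe, P.ip_smul_right]

theorem nondegC
    (h : ∀ x : P.V, x ∈ closure (Submodule.span ℂ {z | ∃ a y, P.l a y = z} : Set P.V)) :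
    Dense (Submodule.span ℂ {z | ∃ a x, P.lC a x = z} : Set (Completion P.V)) := by
  intro x
  refine Completion.induction_on x isClosed_closure fun x => ?_
  refine map_mem_closure (Completion.continuous_coe P.V) (h x) ?_
  intro z hz
  have hz' : z ∈ Submodule.span ℂ {z | ∃ a y, P.l a y = z} := hz
  change (z : Completion P.V) ∈ Submodule.span ℂ {z | ∃ a x, P.lC a x = z}
  clear hz
  induction hz' using Submodule.span_induction with
  | mem z hz =>
    obtain ⟨a, y, rfl⟩ := hz
    exact Submodule.subset_span ⟨a, y, P.lC_coe a y⟩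
  | zero => rw [Completion.coe_zero]; exact Submodule.zero_mem _
  | add z w _ _ hz hw => rw [Completion.coe_add]; exact Submodule.add_mem _ hz hw
  | smul c z _ hz => rw [Completion.coe_smul]; exact Submodule.smul_mem _ c hz

/-- The Hausdorff completion of a pre-correspondence on which `A` acts nondegenerately. -/
noncomputable def completion
    (h : ∀ x : P.V, x ∈ closure (Submodule.span ℂ {z | ∃ a y, P.l a y = z} : Set P.V)) :
    Corr A B where
  carrier := Completion P.V
  rsmul x b := P.rC b x
  inner := P.innerC
  inner_add_right := P.innerC_add
  inner_smul_right := P.innerC_smul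
  inner_rsmul_right x y b :=
    Completion.induction_on₂ x y
      (isClosed_eq (P.cont_innerC continuous_fst (P.cont_rC b continuous_snd))
        ((P.cont_innerC continuous_fst continuous_snd).mul_const b))
      fun x y => by
        rw [rC_coe, innerC_coe, innerC_coe, P.ip_r]
  star_inner x y :=
    Completion.induction_on₂ x y
      (isClosed_eq (P.cont_innerC continuous_fst continuous_snd).star
        (P.cont_innerC continuous_snd continuous_fst))
      fun x y => by
        rw [innerC_coe, innerC_coe, P.star_ip]
  inner_self_nonneg x :=
    Completion.induction_on x
      (isClosed_le continuous_const (P.cont_innerC continuous_id continuous_id))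
      fun x => by
        rw [innerC_coe]
        exact P.ip_nonneg x
  norm_sq_eq x :=
    Completion.induction_on x
      (isClosed_eq (by fun_prop) (P.cont_innerC continuous_id continuous_id).norm)
      fun x => by
        rw [innerC_coe, Completion.norm_coe, P.norm_def, P.nrm_sq]
  lsmul := P.lC
  add_lsmul a b x :=
    Completion.induction_on x
      (isClosed_eq (P.cont_lC _ continuous_id)
        ((P.cont_lC _ continuous_id).add (P.cont_lC _ continuous_id)))
      fun x => by
        rw [lC_coe, lC_coe, lC_coe, P.l_add, Completion.coe_add]
  smul_lsmul c a x :=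
    Completion.induction_on x
      (isClosed_eq (P.cont_lC _ continuous_id) ((P.cont_lC _ continuous_id).const_smul c))
      fun x => by
        rw [lC_coe, lC_coe, P.l_smul, Completion.coe_smul]
  mul_lsmul a b x :=
    Completion.induction_on x
      (isClosed_eq (P.cont_lC _ continuous_id) (P.cont_lC _ (P.cont_lC _ continuous_id)))
      fun x => by
        rw [lC_coe, lC_coe, lC_coe, P.l_mul]
  inner_lsmul_left a x y :=
    Completion.induction_on₂ x y
      (isClosed_eq (P.cont_innerC (P.cont_lC _ continuous_fst) continuous_snd)
        (P.cont_innerC continuous_fst (P.cont_lC _ continuous_snd)))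
      fun x y => by
        rw [lC_coe, lC_coe, innerC_coe, innerC_coe, P.ip_l]
  nondegenerate := P.nondegC h

end Pre

namespace Corr

variable (X : Corr A B) (Y : Corr B C)

theorem norm_tmul_le (x : X.carrier) (y : Y.carrier) :
    (X.toPre.tensor Y.toPre).nrm (x ⊗ₜ[ℂ] y) ≤ ‖x‖ * ‖y‖ := by
  refine abs_le_of_sq_le_sq' ?_ (by positivity) |>.2
  refine (Pre.nrm_sq (X.toPre.tensor Y.toPre) _).le.trans ?_
  change ‖Y.inner y (Y.lsmul (X.inner x x) y)‖ ≤ _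
  refine (Y.norm_inner_le _ _).trans ?_
  refine (mul_le_mul_of_nonneg_left (Y.norm_lsmul_le _ _) (norm_nonneg _)).trans ?_
  refine (mul_le_mul_of_nonneg_left (mul_le_mul_of_nonneg_right (X.norm_inner_le _ _)
    (norm_nonneg _)) (norm_nonneg _)).trans (le_of_eq (by ring))

theorem pure_mem (x : X.carrier) (y : Y.carrier) :
    (x ⊗ₜ[ℂ] y : (X.toPre.tensor Y.toPre).V) ∈ closure
      (Submodule.span ℂ {z | ∃ a w, (X.toPre.tensor Y.toPre).l a w = z} :
        Set (X.toPre.tensor Y.toPre).V) := by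
  let f : X.carrier →L[ℂ] (X.toPre.tensor Y.toPre).V := LinearMap.mkContinuous
    ((TensorProduct.mk ℂ X.carrier Y.carrier).flip y) ‖y‖
    (fun x => by rw [mul_comm]; exact norm_tmul_le X Y x y)
  refine map_mem_closure (f := f) f.continuous (X.nondegenerate x) ?_
  intro z hz
  have hz' : z ∈ Submodule.span ℂ {z | ∃ a x, X.lsmul a x = z} := hz
  change f z ∈ Submodule.span ℂ {z | ∃ a w, (X.toPre.tensor Y.toPre).l a w = z}
  clear hz
  induction hz' using Submodule.span_induction with
  | mem z hz =>
    obtain ⟨a, u, rfl⟩ := hz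
    exact Submodule.subset_span ⟨a, u ⊗ₜ y, rfl⟩
  | zero => rw [map_zero]; exact Submodule.zero_mem _
  | add z w _ _ hz hw => rw [map_add]; exact Submodule.add_mem _ hz hw
  | smul c z _ hz => rw [map_smul]; exact Submodule.smul_mem _ c hz

/-- The balanced tensor product `X ⊗_B Y`: the Hausdorff completion of the algebraic tensor
product with respect to the semi-inner product `⟪x ⊗ y, u ⊗ v⟫ = ⟪y, ⟪x, u⟫ · v⟫`, with
`a · (x ⊗ y) = (a · x) ⊗ y` and `(x ⊗ y) · c = x ⊗ (y · c)`. -/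
noncomputable def tensor : Corr A C :=
  (X.toPre.tensor Y.toPre).completion <| by
    let P := X.toPre.tensor Y.toPre
    let S : Submodule ℂ P.V := (Submodule.span ℂ {z | ∃ a y, P.l a y = z}).topologicalClosure
    change ∀ z, z ∈ S
    intro z
    induction z using TensorProduct.induction_on with
    | zero => exact S.zero_mem
    | add z w hz hw => exact S.add_mem hz hw
    | tmul x y => exact X.pure_mem Y x y

/-- The canonical image of `x ⊗ y` in the balanced tensor product. -/
noncomputable def tmul (x : X.carrier) (y : Y.carrier) : (X.tensor Y).carrier :=
  UniformSpace.Completion.coe' (α := (X.toPre.tensor Y.toPre).V) (x ⊗ₜ[ℂ] y)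

theorem inner_tmul (x u : X.carrier) (y v : Y.carrier) :
    (X.tensor Y).inner (X.tmul Y x y) (X.tmul Y u v) = Y.inner y (Y.lsmul (X.inner x u) v) :=
  (X.toPre.tensor Y.toPre).innerC_coe _ _

theorem lsmul_tmul (a : A) (x : X.carrier) (y : Y.carrier) :
    (X.tensor Y).lsmul a (X.tmul Y x y) = X.tmul Y (X.lsmul a x) y :=
  (X.toPre.tensor Y.toPre).lC_coe _ _

theorem rsmul_tmul (x : X.carrier) (y : Y.carrier) (c : C) :
    (X.tensor Y).rsmul (X.tmul Y x y) c = X.tmul Y x (Y.rsmul y c) :=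
  (X.toPre.tensor Y.toPre).rC_coe _ _

/-- The elementary tensors span a dense subspace. -/
theorem dense_tmul : Dense (Submodule.span ℂ {z | ∃ x y, X.tmul Y x y = z} :
    Set (X.tensor Y).carrier) := by
  let P := X.toPre.tensor Y.toPre
  intro z
  refine UniformSpace.Completion.induction_on (α := P.V) z isClosed_closure fun z => ?_
  refine subset_closure ?_
  induction z using TensorProduct.induction_on with
  | zero => exact Submodule.zero_mem _
  | add z w hz hw =>
    exact (UniformSpace.Completion.coe_add (α := P.V) z w) ▸ Submodule.add_mem _ hz hw
  | tmul x y => exact Submodule.subset_span ⟨x, y, rfl⟩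

end Corr

/-- An isomorphism of `A`-`B` correspondences: a linear bijection preserving the left action and
the inner product (hence also the right action, see `CorrIso.map_rsmul`). -/
structure CorrIso (X Y : Corr A B) where
  toEquiv : X.carrier ≃ₗ[ℂ] Y.carrier
  map_lsmul : ∀ a x, toEquiv (X.lsmul a x) = Y.lsmul a (toEquiv x)
  map_inner : ∀ x y, Y.inner (toEquiv x) (toEquiv y) = X.inner x y

namespace CorrIso

variable {X Y Z : Corr A B}

instance : CoeFun (CorrIso X Y) (fun _ => X.carrier → Y.carrier) := ⟨fun f => f.toEquiv⟩

@[ext]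
theorem ext {f g : CorrIso X Y} (h : ∀ x, f x = g x) : f = g := by
  cases f; cases g
  congr
  exact LinearEquiv.ext h

theorem map_rsmul (f : CorrIso X Y) (x : X.carrier) (b : B) :
    f (X.rsmul x b) = Y.rsmul (f x) b := by
  refine Y.ext_inner fun z => ?_
  obtain ⟨w, rfl⟩ := f.toEquiv.surjective z
  rw [Y.inner_rsmul_right, f.map_inner, f.map_inner, X.inner_rsmul_right]

theorem norm_map (f : CorrIso X Y) (x : X.carrier) : ‖f x‖ = ‖x‖ := by
  refine (sq_eq_sq₀ (norm_nonneg _) (norm_nonneg _)).1 ?_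
  rw [Y.norm_sq_eq, X.norm_sq_eq, f.map_inner]

/-- The underlying bounded operator. -/
noncomputable def toCLM (f : CorrIso X Y) : X.carrier →L[ℂ] Y.carrier :=
  f.toEquiv.toLinearMap.mkContinuous 1 (fun x => by rw [one_mul]; exact (f.norm_map x).le)

/-- The identity isomorphism. -/
def refl (X : Corr A B) : CorrIso X X := ⟨LinearEquiv.refl ℂ _, fun _ _ => rfl, fun _ _ => rfl⟩

/-- The inverse isomorphism. -/
def symm (f : CorrIso X Y) : CorrIso Y X :=
  ⟨f.toEquiv.symm,
    fun a y => by
      rw [LinearEquiv.symm_apply_eq, f.map_lsmul, LinearEquiv.apply_symm_apply],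
    fun x y => by
      rw [← f.map_inner, LinearEquiv.apply_symm_apply, LinearEquiv.apply_symm_apply]⟩

/-- Composition of isomorphisms: first `f`, then `g`. -/
def trans (f : CorrIso X Y) (g : CorrIso Y Z) : CorrIso X Z :=
  ⟨f.toEquiv.trans g.toEquiv,
    fun a x => by simp only [LinearEquiv.trans_apply, f.map_lsmul, g.map_lsmul],
    fun x y => by simp only [LinearEquiv.trans_apply, f.map_inner, g.map_inner]⟩

@[simp] theorem refl_apply (x : X.carrier) : refl X x = x := rfl
@[simp] theorem trans_apply (f : CorrIso X Y) (g : CorrIso Y Z) (x : X.carrier) :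
    f.trans g x = g (f x) := rfl
@[simp] theorem symm_apply_apply (f : CorrIso X Y) (x : X.carrier) : f.symm (f x) = x :=
  f.toEquiv.symm_apply_apply x
@[simp] theorem apply_symm_apply (f : CorrIso X Y) (y : Y.carrier) : f (f.symm y) = y :=
  f.toEquiv.apply_symm_apply y

theorem symm_eq_of (f : CorrIso X Y) {x : X.carrier} {y : Y.carrier} (h : f x = y) :
    f.symm y = x := by rw [← h, symm_apply_apply]

end CorrIso

namespace Corr

/-- A family whose linear span is dense. -/
def Gen (X : HilbertModule B) {I : Type*} (z : I → X.carrier) : Prop :=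
  Dense (Submodule.span ℂ (Set.range z) : Set X.carrier)

variable {X Y : Corr A B}

theorem clm_ext {E F : Type*} [NormedAddCommGroup E] [NormedSpace ℂ E] [NormedAddCommGroup F]
    [NormedSpace ℂ F] {I : Type*} {z : I → E} (hz : Dense (Submodule.span ℂ (Set.range z) : Set E))
    {f g : E →L[ℂ] F} (h : ∀ i, f (z i) = g (z i)) : f = g :=
  ContinuousLinearMap.ext_on hz (by rintro _ ⟨i, rfl⟩; exact h i)

theorem span_linearCombination {E : Type*} [NormedAddCommGroup E] [NormedSpace ℂ E] {I : Type*}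
    {z : I → E} (hz : Dense (Submodule.span ℂ (Set.range z) : Set E)) :
    DenseRange (Finsupp.linearCombination ℂ z) := by
  rw [DenseRange, ← LinearMap.coe_range, Finsupp.range_linearCombination]
  exact hz

section gen

variable {I : Type*} (z : I → X.carrier) (w : I → Y.carrier)

theorem norm_lc (hin : ∀ i j, X.inner (z i) (z j) = Y.inner (w i) (w j)) (f : I →₀ ℂ) :
    ‖Finsupp.linearCombination ℂ w f‖ = ‖Finsupp.linearCombination ℂ z f‖ := by
  refine (sq_eq_sq₀ (norm_nonneg _) (norm_nonneg _)).1 ?_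
  rw [Y.norm_sq_eq, X.norm_sq_eq]
  congr 1
  rw [← innerL_apply, ← innerL_apply, Finsupp.linearCombination_apply,
    Finsupp.linearCombination_apply]
  simp only [Finsupp.sum, map_sum, sum_apply]
  refine Finset.sum_congr rfl fun i _ => Finset.sum_congr rfl fun j _ => ?_
  simp only [innerL_apply, X.inner_smul_left, Y.inner_smul_left, X.inner_smul_right,
    Y.inner_smul_right, hin]

/-- The isometry determined by its values on generators. -/
noncomputable def genIsometry (hz : Gen X.toHilbertModule z) (hw : Gen Y.toHilbertModule w)
    (hin : ∀ i j, X.inner (z i) (z j) = Y.inner (w i) (w j)) : X.carrier ≃ₗᵢ[ℂ] Y.carrier :=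
  LinearEquiv.extendOfIsometry (LinearEquiv.refl ℂ (I →₀ ℂ)) (Finsupp.linearCombination ℂ z)
    (Finsupp.linearCombination ℂ w) (span_linearCombination hz) (span_linearCombination hw)
    (norm_lc z w hin)

theorem genIsometry_apply (hz : Gen X.toHilbertModule z) (hw : Gen Y.toHilbertModule w)
    (hin : ∀ i j, X.inner (z i) (z j) = Y.inner (w i) (w j)) (i : I) :
    genIsometry z w hz hw hin (z i) = w i := by
  have h := LinearEquiv.extendOfIsometry_eq (LinearEquiv.refl ℂ (I →₀ ℂ)) _ _
    (span_linearCombination hz) (span_linearCombination hw) (norm_lc z w hin) (Finsupp.single i 1)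
  simp only [LinearEquiv.refl_apply, Finsupp.linearCombination_single, one_smul] at h
  exact h

/-- Two sesquilinear bounded maps agreeing on generators agree. -/
theorem sesq_ext {E : Type*} [NormedAddCommGroup E] [NormedSpace ℂ E]
    (hz : Gen X.toHilbertModule z) {f g : X.carrier →L⋆[ℂ] X.carrier →L[ℂ] E}
    (h : ∀ i j, f (z i) (z j) = g (z i) (z j)) : f = g := by
  refine ContinuousLinearMap.ext_on hz ?_
  rintro _ ⟨i, rfl⟩
  refine ContinuousLinearMap.ext_on hz ?_
  rintro _ ⟨j, rfl⟩
  exact h i j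

/-- The isomorphism of correspondences determined by its values on generators. -/
noncomputable def isoOfGen (hz : Gen X.toHilbertModule z) (hw : Gen Y.toHilbertModule w)
    (hin : ∀ i j, X.inner (z i) (z j) = Y.inner (w i) (w j))
    (hl : ∀ a i j, X.inner (z i) (X.lsmul a (z j)) = Y.inner (w i) (Y.lsmul a (w j))) :
    CorrIso X Y :=
  let e := genIsometry z w hz hw hin
  have he : ∀ i, e (z i) = w i := genIsometry_apply z w hz hw hin
  let E : X.carrier →L[ℂ] Y.carrier := e.toContinuousLinearEquiv
  have h1 : ((ContinuousLinearMap.compL ℂ X.carrier Y.carrier B).flip E).comp (Y.innerL.comp E)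
      = X.innerL := sesq_ext z hz fun i j => by
    change Y.inner (e (z i)) (e (z j)) = X.inner (z i) (z j)
    rw [he, he, hin]
  have hi : ∀ x y, Y.inner (e x) (e y) = X.inner x y := fun x y => by
    rw [← X.innerL_apply, ← h1]; rfl
  have hm : ∀ a x, e (X.lsmul a x) = Y.lsmul a (e x) := fun a => by
    have h2 : ((ContinuousLinearMap.compL ℂ X.carrier Y.carrier B).flip ((Y.φ a).comp E)).comp
        (Y.innerL.comp E) = ((ContinuousLinearMap.compL ℂ X.carrier X.carrier B).flip (X.φ a)).comp
        X.innerL := sesq_ext z hz fun i j => by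
      change Y.inner (e (z i)) (Y.lsmul a (e (z j))) = X.inner (z i) (X.lsmul a (z j))
      rw [he, he, hl]
    have h3 : ∀ u x, Y.inner (e u) (Y.lsmul a (e x)) = X.inner u (X.lsmul a x) := fun u x =>
      congrArg (fun T : X.carrier →L⋆[ℂ] X.carrier →L[ℂ] B => T u x) h2
    intro x
    refine Y.ext_inner fun v => ?_
    obtain ⟨u, rfl⟩ := e.surjective v
    rw [hi, h3]
  ⟨e.toLinearEquiv, hm, hi⟩

@[simp]
theorem isoOfGen_apply (hz : Gen X.toHilbertModule z) (hw : Gen Y.toHilbertModule w)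
    (hin : ∀ i j, X.inner (z i) (z j) = Y.inner (w i) (w j))
    (hl : ∀ a i j, X.inner (z i) (X.lsmul a (z j)) = Y.inner (w i) (Y.lsmul a (w j))) (i : I) :
    isoOfGen z w hz hw hin hl (z i) = w i := genIsometry_apply z w hz hw hin i

end gen

section tensor

variable (X : Corr A B) (Y : Corr B C)

theorem _root_.CStarCorr.Pre.coe_smul' (P : Pre A B) (c : ℂ) (v : P.V) :
    UniformSpace.Completion.coe' (c • v) = c • UniformSpace.Completion.coe' v :=
  UniformSpace.Completion.coe_smul c v

theorem tmul_eq_coe (x : X.carrier) (y : Y.carrier) : X.tmul Y x y =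
    UniformSpace.Completion.coe' (α := (X.toPre.tensor Y.toPre).V) (x ⊗ₜ[ℂ] y) := rfl

theorem tmul_add (x : X.carrier) (y y' : Y.carrier) :
    X.tmul Y x (y + y') = X.tmul Y x y + X.tmul Y x y' :=
  (congrArg (UniformSpace.Completion.coe' (α := (X.toPre.tensor Y.toPre).V))
    (TensorProduct.tmul_add (R := ℂ) (M := X.carrier) (N := Y.carrier) x y y')).trans
    (UniformSpace.Completion.coe_add _ _)

theorem add_tmul (x x' : X.carrier) (y : Y.carrier) :
    X.tmul Y (x + x') y = X.tmul Y x y + X.tmul Y x' y :=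
  (congrArg (UniformSpace.Completion.coe' (α := (X.toPre.tensor Y.toPre).V))
    (TensorProduct.add_tmul (R := ℂ) (M := X.carrier) (N := Y.carrier) x x' y)).trans
    (UniformSpace.Completion.coe_add _ _)

theorem smul_tmul (c : ℂ) (x : X.carrier) (y : Y.carrier) :
    X.tmul Y (c • x) y = c • X.tmul Y x y :=
  (congrArg (UniformSpace.Completion.coe' (α := (X.toPre.tensor Y.toPre).V))
    (TensorProduct.smul_tmul' (R := ℂ) (M := X.carrier) (N := Y.carrier) c x y).symm).trans
    (Pre.coe_smul' _ c _)

theorem tmul_smul (c : ℂ) (x : X.carrier) (y : Y.carrier) :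
    X.tmul Y x (c • y) = c • X.tmul Y x y :=
  (congrArg (UniformSpace.Completion.coe' (α := (X.toPre.tensor Y.toPre).V))
    (TensorProduct.tmul_smul (R := ℂ) (M := X.carrier) (N := Y.carrier) c x y)).trans
    (Pre.coe_smul' _ c _)

theorem norm_tmul (x : X.carrier) (y : Y.carrier) : ‖X.tmul Y x y‖ ≤ ‖x‖ * ‖y‖ := by
  exact (UniformSpace.Completion.norm_coe (E := (X.toPre.tensor Y.toPre).V) _).le.trans
    (X.norm_tmul_le Y x y)

/-- The bilinear map `(x, y) ↦ x ⊗ y` as a bounded bilinear map. -/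
noncomputable def tmulL : X.carrier →L[ℂ] Y.carrier →L[ℂ] (X.tensor Y).carrier :=
  LinearMap.mkContinuous₂ (LinearMap.mk₂ ℂ (X.tmul Y) (X.add_tmul Y) (X.smul_tmul Y)
    (X.tmul_add Y) (X.tmul_smul Y)) 1 (fun x y => by rw [one_mul]; exact X.norm_tmul Y x y)

@[simp] theorem tmulL_apply (x : X.carrier) (y : Y.carrier) : X.tmulL Y x y = X.tmul Y x y := rfl

/-- A closed subspace containing `f z` for all generators `z` contains the range of `f`. -/
theorem mem_of_gen {E F : Type*} [NormedAddCommGroup E] [NormedSpace ℂ E] [NormedAddCommGroup F]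
    [NormedSpace ℂ F] {s : Set E} (hs : Dense (Submodule.span ℂ s : Set E))
    (S : Submodule ℂ F) (hS : IsClosed (S : Set F)) (f : E →L[ℂ] F)
    (h : ∀ z ∈ s, f z ∈ S) (x : E) : f x ∈ S := by
  have h1 : Submodule.span ℂ s ≤ S.comap f.toLinearMap := Submodule.span_le.2 h
  have h2 : IsClosed {x | f x ∈ S} := hS.preimage f.continuous
  exact h2.closure_subset_iff.2 h1 (hs x)

theorem mem_of_gen' {E : Type*} [NormedAddCommGroup E] [NormedSpace ℂ E]
    {s : Set E} (hs : Dense (Submodule.span ℂ s : Set E))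
    (S : Submodule ℂ E) (hS : IsClosed (S : Set E)) (h : ∀ z ∈ s, z ∈ S) (x : E) : x ∈ S :=
  mem_of_gen hs S hS (ContinuousLinearMap.id ℂ E) h x

variable {X Y}

theorem Gen.tmul {I J : Type*} {z : I → X.carrier} {w : J → Y.carrier}
    (hz : Gen X.toHilbertModule z) (hw : Gen Y.toHilbertModule w) :
    Gen (X.tensor Y).toHilbertModule (fun p : I × J => X.tmul Y (z p.1) (w p.2)) := by
  let S := (Submodule.span ℂ
    (Set.range (fun p : I × J => X.tmul Y (z p.1) (w p.2)))).topologicalClosure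
  have hS : IsClosed (S : Set (X.tensor Y).carrier) := Submodule.isClosed_topologicalClosure _
  have h1 : ∀ x y, X.tmul Y x y ∈ S := fun x =>
    mem_of_gen hw S hS (X.tmulL Y x) <| by
      rintro _ ⟨j, rfl⟩
      refine mem_of_gen hz S hS ((X.tmulL Y).flip (w j)) ?_ x
      rintro _ ⟨i, rfl⟩
      exact Submodule.le_topologicalClosure _ (Submodule.subset_span ⟨(i, j), rfl⟩)
  exact mem_of_gen' (X.dense_tmul Y) S hS (by rintro _ ⟨x, y, rfl⟩; exact h1 x y)

theorem Gen.id (X : HilbertModule B) : Gen X (fun x => x) := by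
  intro x
  exact subset_closure (Submodule.subset_span ⟨x, rfl⟩)

theorem Gen.tmul_id (X : Corr A B) (Y : Corr B C) :
    Gen (X.tensor Y).toHilbertModule (fun p : X.carrier × Y.carrier => X.tmul Y p.1 p.2) :=
  Gen.tmul (X := X) (Y := Y) (z := fun x => x) (w := fun y => y) (Gen.id _) (Gen.id _)

theorem Gen.surj {I J : Type*} {z : I → X.carrier} (hz : Gen X.toHilbertModule z)
    {w : J → X.carrier} (h : ∀ i, ∃ j, w j = z i) : Gen X.toHilbertModule w := by
  refine Dense.mono (Submodule.span_mono ?_) hz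
  rintro _ ⟨i, rfl⟩
  exact h i

/-- The tensor product of two isomorphisms. -/
noncomputable def tensorIso {X X' : Corr A B} {Y Y' : Corr B C} (f : CorrIso X X')
    (g : CorrIso Y Y') : CorrIso (X.tensor Y) (X'.tensor Y') :=
  isoOfGen (fun p : X.carrier × Y.carrier => X.tmul Y p.1 p.2)
    (fun p : X.carrier × Y.carrier => X'.tmul Y' (f p.1) (g p.2)) (Gen.tmul_id X Y)
    ((Gen.tmul_id X' Y').surj fun p => ⟨(f.symm p.1, g.symm p.2), by simp⟩)
    (fun p q => by
      simp only [inner_tmul, f.map_inner, ← g.map_lsmul, g.map_inner])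
    (fun a p q => by
      simp only [lsmul_tmul, inner_tmul, ← f.map_lsmul, f.map_inner, ← g.map_lsmul, g.map_inner])

@[simp]
theorem tensorIso_tmul {X X' : Corr A B} {Y Y' : Corr B C} (f : CorrIso X X')
    (g : CorrIso Y Y') (x : X.carrier) (y : Y.carrier) :
    tensorIso f g (X.tmul Y x y) = X'.tmul Y' (f x) (g y) :=
  isoOfGen_apply (fun p : X.carrier × Y.carrier => X.tmul Y p.1 p.2) _ _ _ _ _ (x, y)

theorem gen_left (X : Corr A B) (Y : Corr B C) (Z : Corr C D) :
    Gen ((X.tensor Y).tensor Z).toHilbertModule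
      (fun p : (X.carrier × Y.carrier) × Z.carrier =>
        (X.tensor Y).tmul Z (X.tmul Y p.1.1 p.1.2) p.2) := by
  have h := Gen.tmul (X := X.tensor Y) (Y := Z) (w := fun z => z) (Gen.tmul_id X Y) (Gen.id _)
  exact h

theorem gen_right (X : Corr A B) (Y : Corr B C) (Z : Corr C D) :
    Gen (X.tensor (Y.tensor Z)).toHilbertModule
      (fun p : (X.carrier × Y.carrier) × Z.carrier =>
        X.tmul (Y.tensor Z) p.1.1 (Y.tmul Z p.1.2 p.2)) := by
  have h := Gen.tmul (X := X) (Y := Y.tensor Z) (z := fun x => x) (Gen.id _) (Gen.tmul_id Y Z)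
  exact Gen.surj (X := X.tensor (Y.tensor Z)) h fun p => ⟨((p.1, p.2.1), p.2.2), rfl⟩

theorem inner_assoc (X : Corr A B) (Y : Corr B C) (Z : Corr C D) (x u : X.carrier)
    (y v : Y.carrier) (z w : Z.carrier) :
    ((X.tensor Y).tensor Z).inner ((X.tensor Y).tmul Z (X.tmul Y x y) z)
      ((X.tensor Y).tmul Z (X.tmul Y u v) w)
      = (X.tensor (Y.tensor Z)).inner (X.tmul (Y.tensor Z) x (Y.tmul Z y z))
        (X.tmul (Y.tensor Z) u (Y.tmul Z v w)) := by
  rw [inner_tmul, inner_tmul, inner_tmul, lsmul_tmul, inner_tmul]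

/-- The associativity isomorphism `(x ⊗ y) ⊗ z ↦ x ⊗ (y ⊗ z)`. -/
noncomputable def assoc (X : Corr A B) (Y : Corr B C) (Z : Corr C D) :
    CorrIso ((X.tensor Y).tensor Z) (X.tensor (Y.tensor Z)) :=
  isoOfGen _ _ (gen_left X Y Z) (gen_right X Y Z) (fun p q => inner_assoc _ _ _ _ _ _ _ _ _)
    (fun a p q => by
      rw [lsmul_tmul, lsmul_tmul, lsmul_tmul]
      exact inner_assoc _ _ _ _ _ _ _ _ _)

@[simp]
theorem assoc_tmul (X : Corr A B) (Y : Corr B C) (Z : Corr C D) (x : X.carrier) (y : Y.carrier)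
    (z : Z.carrier) : assoc X Y Z ((X.tensor Y).tmul Z (X.tmul Y x y) z)
      = X.tmul (Y.tensor Z) x (Y.tmul Z y z) :=
  isoOfGen_apply _ _ (gen_left X Y Z) (gen_right X Y Z) _ _ ((x, y), z)

@[simp]
theorem assoc_symm_tmul (X : Corr A B) (Y : Corr B C) (Z : Corr C D) (x : X.carrier)
    (y : Y.carrier) (z : Z.carrier) : (assoc X Y Z).symm (X.tmul (Y.tensor Z) x (Y.tmul Z y z))
      = (X.tensor Y).tmul Z (X.tmul Y x y) z :=
  (assoc X Y Z).symm_eq_of (assoc_tmul X Y Z x y z)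

end tensor

/-! ### Approximate units and the identity correspondence -/

theorem exists_approx (a : A) {ε : ℝ} (hε : 0 < ε) :
    ∃ e : A, ‖e‖ ≤ 1 ∧ ‖a - a * e‖ < ε ∧ ‖a - e * a‖ < ε := by
  have h := CStarAlgebra.increasingApproximateUnit A
  have : (CStarAlgebra.approximateUnit A).NeBot := h.neBot
  have h1 := (h.tendsto_mul_left a).eventually (Metric.ball_mem_nhds a hε)
  have h2 := (h.tendsto_mul_right a).eventually (Metric.ball_mem_nhds a hε)
  obtain ⟨e, ⟨h1, h2⟩, h3⟩ := ((h1.and h2).and h.eventually_norm).exists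
  change dist (a * e) a < ε at h1
  change dist (e * a) a < ε at h2
  rw [dist_comm, dist_eq_norm] at h1 h2
  exact ⟨e, h3, h1, h2⟩

theorem mem_closure_rsmul (X : HilbertModule B) (x : X.carrier) :
    x ∈ closure {z | ∃ b, X.rsmul x b = z} := by
  rw [Metric.mem_closure_iff]
  intro ε hε
  obtain ⟨e, he, h1, -⟩ := exists_approx (X.inner x x) (ε := ε ^ 2 / 2) (by positivity)
  refine ⟨_, ⟨e, rfl⟩, ?_⟩
  rw [dist_eq_norm]
  refine lt_of_pow_lt_pow_left₀ 2 hε.le ?_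
  have e1 : X.inner (x - X.rsmul x e) (x - X.rsmul x e)
      = (X.inner x x - X.inner x x * e) - star e * (X.inner x x - X.inner x x * e) := by
    rw [sub_eq_add_neg x, ← neg_one_smul ℂ]
    simp only [X.inner_add_left, X.inner_add_right, X.inner_smul_left, X.inner_smul_right,
      X.inner_rsmul_left, X.inner_rsmul_right, mul_sub]
    simp
    abel
  rw [X.norm_sq_eq, e1]
  refine (norm_sub_le _ _).trans_lt ?_
  have h2 := norm_mul_le (star e) (X.inner x x - X.inner x x * e)
  rw [norm_star] at h2
  nlinarith [norm_nonneg (X.inner x x - X.inner x x * e)]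

/-- The identity correspondence `A` over `A`, with the multiplication as actions and
`⟪a, b⟫ = a* b`. -/
noncomputable def one (A : Type u) [NonUnitalCStarAlgebra A] : Corr A A where
  carrier := A
  rsmul a b := a * b
  inner a b := star a * b
  inner_add_right _ _ _ := mul_add _ _ _
  inner_smul_right _ _ _ := mul_smul_comm _ _ _
  inner_rsmul_right _ _ _ := (mul_assoc _ _ _).symm
  star_inner _ _ := by rw [star_mul, star_star]
  inner_self_nonneg a := star_mul_self_nonneg a
  norm_sq_eq a := by rw [CStarRing.norm_star_mul_self, sq]
  lsmul a b := a * b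
  add_lsmul := add_mul
  smul_lsmul := smul_mul_assoc
  mul_lsmul := mul_assoc
  inner_lsmul_left _ _ _ := by rw [star_mul, mul_assoc]
  nondegenerate a := by
    rw [Metric.mem_closure_iff]
    intro ε hε
    obtain ⟨e, -, h, -⟩ := exists_approx a hε
    exact ⟨a * e, Submodule.subset_span ⟨a, e, rfl⟩, by rwa [dist_eq_norm]⟩

theorem lsmul_rsmul (X : Corr A B) (a : A) (x : X.carrier) (b : B) :
    X.lsmul a (X.rsmul x b) = X.rsmul (X.lsmul a x) b :=
  X.ext_inner fun z => by
    rw [X.inner_lsmul_right, X.inner_rsmul_right, X.inner_rsmul_right, X.inner_lsmul_right]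

theorem inner_lsmul_lsmul (X : Corr A B) (a b : A) (x y : X.carrier) :
    X.inner x (X.lsmul (star a * b) y) = X.inner (X.lsmul a x) (X.lsmul b y) := by
  rw [X.mul_lsmul, X.inner_lsmul_left]

theorem inner_rsmul_rsmul (X : Corr A B) (b c : B) (x y : X.carrier) :
    star b * (X.inner x y * c) = X.inner (X.rsmul x b) (X.rsmul y c) := by
  rw [X.inner_rsmul_left, X.inner_rsmul_right]

/-- The isomorphism `A ⊗_A X → X`, `a ⊗ x ↦ a · x`. -/
noncomputable def leftUnit (X : Corr A B) : CorrIso ((one A).tensor X) X :=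
  isoOfGen (fun p : (one A).carrier × X.carrier => (one A).tmul X p.1 p.2)
    (fun p => X.lsmul p.1 p.2) (Gen.tmul_id (one A) X)
    (Dense.mono (Submodule.span_mono (by rintro _ ⟨a, x, rfl⟩; exact ⟨(a, x), rfl⟩))
      X.nondegenerate)
    (fun p q => ((one A).inner_tmul X p.1 q.1 p.2 q.2).trans (X.inner_lsmul_lsmul p.1 q.1 p.2 q.2))
    (fun a p q => by
      rw [lsmul_tmul]
      refine ((one A).inner_tmul X p.1 _ p.2 q.2).trans
        ((X.inner_lsmul_lsmul p.1 (a * (show A from q.1)) p.2 q.2).trans ?_)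
      rw [X.mul_lsmul])

theorem leftUnit_tmul (X : Corr A B) (a : A) (x : X.carrier) :
    leftUnit X ((one A).tmul X a x) = X.lsmul a x :=
  isoOfGen_apply (fun p : (one A).carrier × X.carrier => (one A).tmul X p.1 p.2) _ _ _ _ _ (a, x)

/-- The isomorphism `X ⊗_B B → X`, `x ⊗ b ↦ x · b`. -/
noncomputable def rightUnit (X : Corr A B) : CorrIso (X.tensor (one B)) X :=
  isoOfGen (fun p : X.carrier × (one B).carrier => X.tmul (one B) p.1 p.2)
    (fun p => X.rsmul p.1 p.2) (Gen.tmul_id X (one B))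
    (fun x => closure_mono (by
      rintro _ ⟨b, rfl⟩
      exact Submodule.subset_span ⟨(x, b), rfl⟩) (mem_closure_rsmul X.toHilbertModule x))
    (fun p q => (X.inner_tmul (one B) p.1 q.1 p.2 q.2).trans
      (X.inner_rsmul_rsmul p.2 q.2 p.1 q.1))
    (fun a p q => by
      rw [lsmul_tmul]
      exact ((X.inner_tmul (one B) p.1 _ p.2 q.2).trans
        (X.inner_rsmul_rsmul p.2 q.2 p.1 (X.lsmul a q.1))).trans
        (congrArg (X.inner (X.rsmul p.1 p.2)) (X.lsmul_rsmul a q.1 q.2).symm))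

theorem rightUnit_tmul (X : Corr A B) (x : X.carrier) (b : B) :
    rightUnit X (X.tmul (one B) x b) = X.rsmul x b :=
  isoOfGen_apply (fun p : X.carrier × (one B).carrier => X.tmul (one B) p.1 p.2) _ _ _ _ _ (x, b)

end Corr

/-! ### Compact operators, regularity, and the Katsura ideal -/

namespace Pre

variable (P : Pre A B)

theorem norm_sq_le_of_symm (T : P.V →ₗ[ℂ] P.V) (hT : ∀ v w, P.ip (T v) w = P.ip v (T w)) (v : P.V)
    (k : ℕ) : ‖(T ^ k) v‖ ^ 2 ≤ ‖v‖ * ‖(T ^ (2 * k)) v‖ := by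
  have h : ∀ (n : ℕ) (w : P.V), P.ip ((T ^ n) v) w = P.ip v ((T ^ n) w) := by
    intro n
    induction n with
    | zero => intro w; simp
    | succ n ih => intro w; rw [pow_succ', Module.End.mul_apply, hT, ih, ← Module.End.mul_apply,
        ← pow_succ, pow_succ']
  rw [P.norm_def, P.nrm_sq, h, ← Module.End.mul_apply, ← pow_add, ← two_mul]
  exact P.norm_ip_le _ _

/-- A symmetric operator with orbits of growth rate `ρ` is bounded by `ρ`. -/
theorem norm_le_of_symm (T : P.V →ₗ[ℂ] P.V) (hT : ∀ v w, P.ip (T v) w = P.ip v (T w)) {ρ : ℝ}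
    (hρ : 0 ≤ ρ) (v : P.V) (hv : ∃ K : ℝ, ∀ n : ℕ, ‖(T ^ n) v‖ ≤ K * ρ ^ n) :
    ‖T v‖ ≤ ρ * ‖v‖ := by
  by_contra! hlt
  obtain ⟨K, hK⟩ := hv
  have h1 := P.norm_sq_le_of_symm T hT v 1
  rw [pow_one] at h1
  have hTv : 0 < ‖T v‖ := lt_of_le_of_lt (by positivity) hlt
  have hv0 : 0 < ‖v‖ := by
    rcases (norm_nonneg v).eq_or_lt with h | h
    · rw [← h, zero_mul] at h1
      exact absurd h1 (not_le.2 (by positivity))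
    · exact h
  obtain ⟨r, hr⟩ : ∃ r, r = ‖T v‖ / ‖v‖ := ⟨_, rfl⟩
  have hrρ : ρ < r := by rw [hr, lt_div_iff₀ hv0]; exact hlt
  have hr0 : 0 < r := hρ.trans_lt hrρ
  have h2 : ∀ k : ℕ, r ^ (2 ^ k) * ‖v‖ ≤ ‖(T ^ (2 ^ k)) v‖ := by
    intro k
    induction k with
    | zero => rw [pow_zero, pow_one, pow_one, hr, div_mul_cancel₀ _ hv0.ne']
    | succ k ih =>
      have h3 := P.norm_sq_le_of_symm T hT v (2 ^ k)
      have h4 : (r ^ 2 ^ k * ‖v‖) ^ 2 ≤ ‖v‖ * ‖(T ^ (2 * 2 ^ k)) v‖ :=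
        (pow_le_pow_left₀ (by positivity) ih 2).trans h3
      have e : 2 ^ (k + 1) = 2 * 2 ^ k := by ring
      rw [e]
      have e2 : (r ^ 2 ^ k * ‖v‖) ^ 2 = ‖v‖ * (r ^ (2 * 2 ^ k) * ‖v‖) := by ring
      rw [e2] at h4
      exact le_of_mul_le_mul_left h4 hv0
  rcases hρ.eq_or_lt with h | h
  · have h3 := (h2 0).trans (hK _)
    rw [← h, pow_zero, pow_one, pow_one, mul_zero] at h3
    exact absurd h3 (not_le.2 (by positivity))
  · have hq : 1 < r / ρ := by rwa [one_lt_div h]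
    obtain ⟨n, hn⟩ := pow_unbounded_of_one_lt (K / ‖v‖) hq
    have h3 := (h2 n).trans (hK _)
    have h4 : (r / ρ) ^ n ≤ (r / ρ) ^ (2 ^ n) :=
      pow_le_pow_right₀ hq.le Nat.lt_two_pow_self.le
    have h5 : (r / ρ) ^ (2 ^ n) ≤ K / ‖v‖ := by
      rw [div_pow, div_le_div_iff₀ (by positivity) hv0]
      exact h3
    linarith

end Pre

namespace Corr

theorem norm_adj_le (X : Corr A B) {S S' : X.carrier →L[ℂ] X.carrier}
    (h : ∀ x y, X.inner (S x) y = X.inner x (S' y)) : ‖S'‖ ≤ ‖S‖ := by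
  refine S'.opNorm_le_bound (norm_nonneg _) fun x => ?_
  have h1 : ‖S' x‖ ^ 2 ≤ ‖S‖ * ‖x‖ * ‖S' x‖ := by
    have e : X.inner (S' x) (S' x) = X.inner (S (S' x)) x := (h _ _).symm
    rw [X.norm_sq_eq, e]
    refine (X.norm_inner_le _ _).trans ?_
    have := S.le_opNorm (S' x)
    nlinarith [norm_nonneg x]
  rcases (norm_nonneg (S' x)).eq_or_lt with h0 | h0
  · rw [← h0]; positivity
  · rw [sq] at h1
    exact le_of_mul_le_mul_right h1 h0

/-- Elementary tensors in the algebraic tensor product. -/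
def tm (X : Corr A B) (Y : Corr B C) (x : X.carrier) (y : Y.carrier) :
    (X.toPre.tensor Y.toPre).V := TensorProduct.tmul ℂ (M := X.carrier) (N := Y.carrier) x y

theorem V_induction (X : Corr A B) (Y : Corr B C) {p : (X.toPre.tensor Y.toPre).V → Prop}
    (zero : p 0) (add : ∀ v w, p v → p w → p (v + w)) (tmul : ∀ x y, p (X.tm Y x y))
    (v : (X.toPre.tensor Y.toPre).V) : p v :=
  TensorProduct.induction_on (R := ℂ) (M := X.toPre.V) (N := Y.toPre.V) (motive := p) v zero tmul
    add

/-- The operator `S ⊗ 1` on the algebraic tensor product. -/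
noncomputable def ampl (X : Corr A B) (Y : Corr B C) (S : X.carrier →L[ℂ] X.carrier) :
    (X.toPre.tensor Y.toPre).V →ₗ[ℂ] (X.toPre.tensor Y.toPre).V :=
  LinearMap.rTensor Y.carrier S.toLinearMap

theorem ampl_tm (X : Corr A B) (Y : Corr B C) (S : X.carrier →L[ℂ] X.carrier) (x : X.carrier)
    (y : Y.carrier) : X.ampl Y S (X.tm Y x y) = X.tm Y (S x) y := rfl

theorem ip_tm (X : Corr A B) (Y : Corr B C) (x u : X.carrier) (y v : Y.carrier) :
    (X.toPre.tensor Y.toPre).ip (X.tm Y x y) (X.tm Y u v)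
      = Y.inner y (Y.lsmul (X.inner x u) v) := rfl

theorem ampl_adj (X : Corr A B) (Y : Corr B C) {S S' : X.carrier →L[ℂ] X.carrier}
    (h : ∀ x y, X.inner (S x) y = X.inner x (S' y)) (v w : (X.toPre.tensor Y.toPre).V) :
    (X.toPre.tensor Y.toPre).ip (X.ampl Y S v) w
      = (X.toPre.tensor Y.toPre).ip v (X.ampl Y S' w) := by
  induction v using V_induction X Y with
  | zero => simp only [map_zero, LinearMap.zero_apply]
  | add v v' hv hv' => simp only [map_add, LinearMap.add_apply, hv, hv']
  | tmul x y =>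
    induction w using V_induction X Y with
    | zero => simp only [map_zero]
    | add w w' hw hw' => simp only [map_add, hw, hw']
    | tmul u z => rw [ampl_tm, ampl_tm, ip_tm, ip_tm, h]

theorem ampl_pow_le (X : Corr A B) (Y : Corr B C) {S S' : X.carrier →L[ℂ] X.carrier}
    (h : ∀ x y, X.inner (S x) y = X.inner x (S' y)) (v : (X.toPre.tensor Y.toPre).V) :
    ∃ K : ℝ, ∀ n : ℕ, ‖((X.ampl Y S' * X.ampl Y S) ^ n) v‖ ≤ K * (‖S‖ ^ 2) ^ n := by
  induction v using V_induction X Y with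
  | zero => exact ⟨0, fun n => by rw [map_zero, norm_zero, zero_mul]⟩
  | add v v' hv hv' =>
    obtain ⟨K, hK⟩ := hv
    obtain ⟨K', hK'⟩ := hv'
    refine ⟨K + K', fun n => ?_⟩
    rw [map_add, add_mul]
    exact (norm_add_le _ _).trans (add_le_add (hK n) (hK' n))
  | tmul x y =>
    refine ⟨‖x‖ * ‖y‖, fun n => ?_⟩
    have e : ∀ n : ℕ, ((X.ampl Y S' * X.ampl Y S) ^ n) (X.tm Y x y)
        = X.tm Y (((S' * S) ^ n) x) y := by
      intro n
      induction n with
      | zero => rfl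
      | succ n ih =>
        rw [pow_succ', Module.End.mul_apply, ih, pow_succ']
        rfl
    rw [e]
    refine (X.norm_tmul_le Y _ _).trans ?_
    have h3 : ‖(S' * S) ^ n‖ ≤ (‖S‖ ^ 2) ^ n := by
      rcases Nat.eq_zero_or_pos n with rfl | hn
      · rw [pow_zero, pow_zero]
        exact ContinuousLinearMap.norm_id_le
      · refine (norm_pow_le' _ hn).trans (pow_le_pow_left₀ (norm_nonneg _) ?_ n)
        refine (norm_mul_le _ _).trans ?_
        rw [sq]
        exact mul_le_mul_of_nonneg_right (X.norm_adj_le h) (norm_nonneg _)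
    have h4 := ((S' * S) ^ n).le_of_opNorm_le h3 x
    have h5 := mul_le_mul_of_nonneg_right h4 (norm_nonneg y)
    exact h5.trans (le_of_eq (by ring))

theorem norm_ampl_le (X : Corr A B) (Y : Corr B C) {S S' : X.carrier →L[ℂ] X.carrier}
    (h : ∀ x y, X.inner (S x) y = X.inner x (S' y)) (v : (X.toPre.tensor Y.toPre).V) :
    ‖X.ampl Y S v‖ ≤ ‖S‖ * ‖v‖ := by
  have hs : ∀ x y, X.inner (S' x) y = X.inner x (S y) := fun x y => by
    rw [← X.star_inner, ← h, X.star_inner]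
  have h3 := (X.toPre.tensor Y.toPre).norm_le_of_symm (X.ampl Y S' * X.ampl Y S)
    (fun v w => by
      rw [Module.End.mul_apply, Module.End.mul_apply, ampl_adj X Y hs, ampl_adj X Y h])
    (sq_nonneg ‖S‖) v (ampl_pow_le X Y h v)
  have h4 : ‖X.ampl Y S v‖ ^ 2 ≤ (‖S‖ * ‖v‖) ^ 2 := by
    rw [Pre.norm_def _ (X.ampl Y S v), Pre.nrm_sq, ampl_adj X Y h]
    refine ((X.toPre.tensor Y.toPre).norm_ip_le _ _).trans ?_
    refine (mul_le_mul_of_nonneg_left h3 (Pre.nrm_nonneg _ v)).trans (le_of_eq ?_)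
    rw [Pre.norm_def _ v]
    ring
  exact abs_le_of_sq_le_sq' h4 (by positivity) |>.2

/-- If `R` is the operator `S ⊗ 1` with `S` adjointable then `‖R‖ ≤ ‖S‖`. -/
theorem norm_le_of_tmul (X : Corr A B) (Y : Corr B C) {S S' : X.carrier →L[ℂ] X.carrier}
    (h : ∀ x y, X.inner (S x) y = X.inner x (S' y))
    (R : (X.tensor Y).carrier →L[ℂ] (X.tensor Y).carrier)
    (hR : ∀ x y, R (X.tmul Y x y) = X.tmul Y (S x) y) : ‖R‖ ≤ ‖S‖ := by
  let P := X.toPre.tensor Y.toPre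
  have e : ∀ v : P.V, R (UniformSpace.Completion.coe' (α := P.V) v)
      = UniformSpace.Completion.coe' (α := P.V) (X.ampl Y S v) := by
    intro v
    induction v using V_induction X Y with
    | zero => rw [map_zero]; exact map_zero R
    | add v w hv hw =>
      rw [map_add]
      refine ((congrArg R (UniformSpace.Completion.coe_add v w)).trans
        ((map_add R _ _).trans ?_)).trans (UniformSpace.Completion.coe_add (α := P.V) _ _).symm
      exact congrArg₂ (· + ·) hv hw
    | tmul x y => exact hR x y
  refine R.opNorm_le_bound (norm_nonneg _) fun z => ?_
  refine UniformSpace.Completion.induction_on (α := P.V) z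
    (isClosed_le R.continuous.norm (continuous_const.mul continuous_norm)) fun v => ?_
  rw [e]
  have h1 := UniformSpace.Completion.norm_coe (E := P.V) v
  have h2 := UniformSpace.Completion.norm_coe (E := P.V) (X.ampl Y S v)
  exact h2.le.trans ((norm_ampl_le X Y h v).trans
    (mul_le_mul_of_nonneg_left h1.ge (norm_nonneg _)))

/-- The rank-one operator `θ_{x,y} : z ↦ x · ⟪y, z⟫`. -/
noncomputable def theta (X : Corr A B) (x y : X.carrier) : X.carrier →L[ℂ] X.carrier :=
  LinearMap.mkContinuous
    ⟨⟨fun z => X.rsmul x (X.inner y z), fun z w => by rw [X.inner_add_right, X.rsmul_add]⟩,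
      fun c z => (congrArg (X.rsmul x) (X.inner_smul_right c y z)).trans (X.rsmul_smul c x _)⟩ (‖x‖ * ‖y‖) (fun z =>
        (X.norm_rsmul_le _ _).trans ((mul_le_mul_of_nonneg_left (X.norm_inner_le y z)
          (norm_nonneg x)).trans (mul_assoc _ _ _).symm.le))

@[simp] theorem theta_apply (X : Corr A B) (x y z : X.carrier) :
    X.theta x y z = X.rsmul x (X.inner y z) := rfl

/-- The compact operators `K(X)`: the closed linear span of the rank-one operators. -/
noncomputable def compacts (X : Corr A B) : Submodule ℂ (X.carrier →L[ℂ] X.carrier) :=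
  (Submodule.span ℂ {T | ∃ x y, X.theta x y = T}).topologicalClosure

/-- A correspondence is regular if `A` acts faithfully and by compact operators. -/
def IsRegular (X : Corr A B) : Prop :=
  Function.Injective X.φ ∧ ∀ a, X.φ a ∈ X.compacts

/-- The Katsura ideal `J_X = φ_X⁻¹(K(X)) ∩ (ker φ_X)^⊥`. -/
def katsuraIdeal (X : Corr A A) : Set A :=
  {a | X.φ a ∈ X.compacts ∧ ∀ b, X.φ b = 0 → a * b = 0}

/-- The closed subspace `J · M` of `M`, for `J ⊆ A`. -/
noncomputable def leftSub (M : Corr A B) (J : Set A) : Submodule ℂ M.carrier :=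
  (Submodule.span ℂ {z | ∃ a ∈ J, ∃ m, M.lsmul a m = z}).topologicalClosure

/-- The closed subspace `M · J` of `M`, for `J ⊆ B`. -/
noncomputable def rightSub (M : Corr A B) (J : Set B) : Submodule ℂ M.carrier :=
  (Submodule.span ℂ {z | ∃ b ∈ J, ∃ m, M.rsmul m b = z}).topologicalClosure

theorem theta_mem (X : Corr A B) (x y : X.carrier) : X.theta x y ∈ X.compacts :=
  Submodule.le_topologicalClosure _ (Submodule.subset_span ⟨x, y, rfl⟩)

theorem isClosed_compacts (X : Corr A B) :
    IsClosed (X.compacts : Set (X.carrier →L[ℂ] X.carrier)) :=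
  Submodule.isClosed_topologicalClosure _

theorem theta_add_left (X : Corr A B) (x x' y : X.carrier) :
    X.theta (x + x') y = X.theta x y + X.theta x' y := by
  ext z; simp [X.add_rsmul]

theorem theta_smul_left (X : Corr A B) (c : ℂ) (x y : X.carrier) :
    X.theta (c • x) y = c • X.theta x y := by
  ext z; simp [X.smul_rsmul]

theorem norm_theta_le (X : Corr A B) (x y : X.carrier) : ‖X.theta x y‖ ≤ ‖x‖ * ‖y‖ :=
  LinearMap.mkContinuous_norm_le _ (by positivity) _

theorem theta_adj (X : Corr A B) (x y u v : X.carrier) :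
    X.inner (X.theta x y u) v = X.inner u (X.theta y x v) := by
  rw [theta_apply, theta_apply, X.inner_rsmul_left, X.inner_rsmul_right, X.star_inner]

section tensor

variable (X : Corr A B) (Y : Corr B C)

theorem rsmul_tmul_eq (x : X.carrier) (b : B) (y : Y.carrier) :
    X.tmul Y (X.rsmul x b) y = X.tmul Y x (Y.lsmul b y) := by
  refine (X.tensor Y).ext_inner fun z => ?_
  have h : ∀ s t : (X.tensor Y).carrier, (X.tensor Y).innerL.flip s = (X.tensor Y).innerL.flip t →
      (X.tensor Y).inner z s = (X.tensor Y).inner z t := fun s t hst =>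
    congrArg (fun T : (X.tensor Y).carrier →L⋆[ℂ] C => T z) hst
  refine h _ _ (ContinuousLinearMap.ext_on (Gen.tmul_id X Y) ?_)
  rintro _ ⟨p, rfl⟩
  change (X.tensor Y).inner (X.tmul Y p.1 p.2) _ = (X.tensor Y).inner (X.tmul Y p.1 p.2) _
  rw [inner_tmul, inner_tmul, X.inner_rsmul_right, Y.mul_lsmul]

/-- The bilinear map `(v, w) ↦ ⟪x, v⟫ · w`. -/
noncomputable def annBil (x : X.carrier) : X.carrier →ₗ[ℂ] Y.carrier →ₗ[ℂ] Y.carrier :=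
  LinearMap.mk₂ ℂ
    (fun (v : X.carrier) (w : Y.carrier) => Y.lsmul (X.inner x v) w)
    (fun v v' w => by rw [X.inner_add_right, Y.add_lsmul])
    (fun c v w => by rw [X.inner_smul_right, Y.smul_lsmul])
    (fun v w w' => by rw [Y.lsmul_add])
    (fun c v w => by rw [Y.lsmul_smul])

/-- Annihilation `v ⊗ w ↦ ⟪x, v⟫ · w` on the algebraic tensor product. -/
noncomputable def annAlg (x : X.carrier) : (X.toPre.tensor Y.toPre).V →ₗ[ℂ] Y.carrier :=
  TensorProduct.lift (X.annBil Y x)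

theorem inner_zero_right (X : HilbertModule B) (x : X.carrier) : X.inner x 0 = 0 := by
  rw [← zero_smul ℂ (0 : X.carrier), X.inner_smul_right, zero_smul]

theorem inner_zero_left (X : HilbertModule B) (x : X.carrier) : X.inner 0 x = 0 := by
  rw [← X.star_inner, inner_zero_right, star_zero]

theorem inner_sub_right (X : HilbertModule B) (x y z : X.carrier) :
    X.inner x (y - z) = X.inner x y - X.inner x z := by
  rw [sub_eq_add_neg, ← neg_one_smul ℂ z, X.inner_add_right, X.inner_smul_right, neg_one_smul,
    sub_eq_add_neg]

theorem inner_sub_left (X : HilbertModule B) (x y z : X.carrier) :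
    X.inner (x - y) z = X.inner x z - X.inner y z := by
  rw [← X.star_inner, inner_sub_right, star_sub, X.star_inner, X.star_inner]

theorem sub_tmul (x x' : X.carrier) (y : Y.carrier) :
    X.tmul Y (x - x') y = X.tmul Y x y - X.tmul Y x' y := by
  rw [sub_eq_add_neg, ← neg_one_smul ℂ x', add_tmul, smul_tmul, neg_one_smul, sub_eq_add_neg]

theorem zero_tmul (y : Y.carrier) : X.tmul Y 0 y = 0 := by
  rw [← zero_smul ℂ (0 : X.carrier), smul_tmul, zero_smul]

theorem inner_annAlg (x : X.carrier) (y : Y.carrier) (v : (X.toPre.tensor Y.toPre).V) :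
    Y.inner y (X.annAlg Y x v) = (X.toPre.tensor Y.toPre).ip (X.tm Y x y) v := by
  induction v using V_induction X Y with
  | zero => rw [map_zero, map_zero, inner_zero_right]
  | add v w hv hw => rw [map_add, map_add, Y.inner_add_right, hv, hw]
  | tmul u z => rfl

theorem norm_annAlg_le (x : X.carrier) (v : (X.toPre.tensor Y.toPre).V) :
    ‖X.annAlg Y x v‖ ≤ ‖x‖ * ‖v‖ := by
  let P := X.toPre.tensor Y.toPre
  have h1 : ‖X.annAlg Y x v‖ ^ 2 ≤ ‖x‖ * ‖v‖ * ‖X.annAlg Y x v‖ := by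
    rw [Y.norm_sq_eq, inner_annAlg]
    refine (P.norm_ip_le _ _).trans ?_
    refine (mul_le_mul_of_nonneg_right (X.norm_tmul_le Y _ _) (P.nrm_nonneg _)).trans ?_
    rw [P.norm_def]
    exact le_of_eq (by ring)
  rcases (norm_nonneg (X.annAlg Y x v)).eq_or_lt with h0 | h0
  · rw [← h0]; positivity
  · rw [sq] at h1
    exact le_of_mul_le_mul_right h1 h0

/-- Annihilation `v ⊗ w ↦ ⟪x, v⟫ · w`, the adjoint of `y ↦ x ⊗ y`. -/
noncomputable def ann (x : X.carrier) : (X.tensor Y).carrier →L[ℂ] Y.carrier :=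
  ContinuousLinearMap.extend
    (LinearMap.mkContinuous (X.annAlg Y x) ‖x‖ (X.norm_annAlg_le Y x))
    (UniformSpace.Completion.toComplL (𝕜 := ℂ) (E := (X.toPre.tensor Y.toPre).V))

theorem ann_tmul (x v : X.carrier) (w : Y.carrier) :
    X.ann Y x (X.tmul Y v w) = Y.lsmul (X.inner x v) w :=
  ContinuousLinearMap.extend_eq
    (LinearMap.mkContinuous (X.annAlg Y x) ‖x‖ (X.norm_annAlg_le Y x))
    (UniformSpace.Completion.denseRange_coe)
    (UniformSpace.Completion.isUniformInducing_coe _) (X.tm Y v w)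

/-- `T ↦ (v ⊗ w ↦ x ⊗ T ⟪u, v⟫ w)`. -/
noncomputable def sandwich (x u : X.carrier) :
    (Y.carrier →L[ℂ] Y.carrier) →L[ℂ] ((X.tensor Y).carrier →L[ℂ] (X.tensor Y).carrier) :=
  (ContinuousLinearMap.compL ℂ _ _ _ (X.tmulL Y x)).comp
    ((ContinuousLinearMap.compL ℂ _ _ _).flip (X.ann Y u))

theorem sandwich_tmul (x u v : X.carrier) (w : Y.carrier) (T : Y.carrier →L[ℂ] Y.carrier) :
    X.sandwich Y x u T (X.tmul Y v w) = X.tmul Y x (T (Y.lsmul (X.inner u v) w)) := by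
  change X.tmul Y x (T (X.ann Y u (X.tmul Y v w))) = _
  rw [ann_tmul]

theorem tensor_clm_ext {E : Type*} [NormedAddCommGroup E] [NormedSpace ℂ E]
    {f g : (X.tensor Y).carrier →L[ℂ] E}
    (h : ∀ x y, f (X.tmul Y x y) = g (X.tmul Y x y)) : f = g :=
  clm_ext (Gen.tmul_id X Y) fun p => h p.1 p.2

theorem sandwich_mem (x u : X.carrier) {T : Y.carrier →L[ℂ] Y.carrier} (hT : T ∈ Y.compacts) :
    X.sandwich Y x u T ∈ (X.tensor Y).compacts := by
  have h1 : Submodule.span ℂ {T | ∃ x y, Y.theta x y = T} ≤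
      (X.tensor Y).compacts.comap (X.sandwich Y x u).toLinearMap := by
    rw [Submodule.span_le]
    rintro _ ⟨y, v, rfl⟩
    change X.sandwich Y x u (Y.theta y v) ∈ (X.tensor Y).compacts
    have e : X.sandwich Y x u (Y.theta y v) = (X.tensor Y).theta (X.tmul Y x y) (X.tmul Y u v) :=
      X.tensor_clm_ext Y fun m n => by
        rw [sandwich_tmul, theta_apply, theta_apply, rsmul_tmul, inner_tmul]
    rw [e]
    exact theta_mem _ _ _
  exact ((X.tensor Y).isClosed_compacts.preimage
    (X.sandwich Y x u).continuous).closure_subset_iff.2 h1 hT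

variable {X Y}

/-- `θ_{x,u} ⊗ 1` is compact if `B` acts by compact operators on `Y`. -/
theorem exists_theta_tensor (hY : ∀ b, Y.φ b ∈ Y.compacts) (x u : X.carrier) :
    ∃ R ∈ (X.tensor Y).compacts, ∀ v w, R (X.tmul Y v w) = X.tmul Y (X.theta x u v) w := by
  let R : X.carrier →L[ℂ] ((X.tensor Y).carrier →L[ℂ] (X.tensor Y).carrier) :=
    ((ContinuousLinearMap.compL ℂ _ _ _).flip (X.ann Y u)).comp (X.tmulL Y)
  have hR : ∀ x v w, R x (X.tmul Y v w) = X.tmul Y (X.theta x u v) w := fun x v w => by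
    change X.tmul Y x (X.ann Y u (X.tmul Y v w)) = _
    rw [ann_tmul, theta_apply, rsmul_tmul_eq]
  refine ⟨R x, ?_, hR x⟩
  have h1 : ∀ z ∈ {z | ∃ b, X.rsmul x b = z}, R z ∈ (X.tensor Y).compacts := by
    rintro _ ⟨b, rfl⟩
    have e : R (X.rsmul x b) = X.sandwich Y x u (Y.φ b) := X.tensor_clm_ext Y fun m n => by
      rw [hR, sandwich_tmul, theta_apply, X.rsmul_rsmul, rsmul_tmul_eq, Y.mul_lsmul, φ_apply]
    rw [e]
    exact X.sandwich_mem Y x u (hY b)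
  exact ((X.tensor Y).isClosed_compacts.preimage R.continuous).closure_subset_iff.2 h1
    (mem_closure_rsmul X.toHilbertModule x)

theorem exists_span_tensor (hY : ∀ b, Y.φ b ∈ Y.compacts) {F : X.carrier →L[ℂ] X.carrier}
    (hF : F ∈ Submodule.span ℂ {T | ∃ x y, X.theta x y = T}) :
    (∃ F' : X.carrier →L[ℂ] X.carrier, ∀ x y, X.inner (F x) y = X.inner x (F' y)) ∧
    ∃ R ∈ (X.tensor Y).compacts, ∀ v w, R (X.tmul Y v w) = X.tmul Y (F v) w := by
  induction hF using Submodule.span_induction with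
  | mem F hF =>
    obtain ⟨x, y, rfl⟩ := hF
    exact ⟨⟨X.theta y x, X.theta_adj x y⟩, exists_theta_tensor hY x y⟩
  | zero =>
    refine ⟨⟨0, fun x y => ?_⟩, 0, Submodule.zero_mem _, fun v w => ?_⟩
    · exact (inner_zero_left _ y).trans (inner_zero_right _ x).symm
    · exact (zero_tmul X Y w).symm
  | add F G _ _ hF hG =>
    obtain ⟨⟨F', hF'⟩, R, hR, hR'⟩ := hF
    obtain ⟨⟨G', hG'⟩, T, hT, hT'⟩ := hG
    refine ⟨⟨F' + G', fun x y => ?_⟩, R + T, Submodule.add_mem _ hR hT, fun v w => ?_⟩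
    · simp only [add_apply, X.inner_add_left, X.inner_add_right, hF', hG']
    · simp only [add_apply, hR', hT', add_tmul]
  | smul c F _ hF =>
    obtain ⟨⟨F', hF'⟩, R, hR, hR'⟩ := hF
    refine ⟨⟨star c • F', fun x y => ?_⟩, c • R, Submodule.smul_mem _ c hR, fun v w => ?_⟩
    · simp only [smul_apply, X.inner_smul_left, X.inner_smul_right, hF']
    · simp only [smul_apply, hR', smul_tmul]

theorem tensor_regular (hX : X.IsRegular) (hY : Y.IsRegular) : (X.tensor Y).IsRegular := by
  refine ⟨fun a b hab => ?_, fun a => ?_⟩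
  · refine hX.1 (ContinuousLinearMap.ext fun x => ?_)
    have h1 : ∀ y, Y.lsmul (X.inner (X.lsmul (a - b) x) (X.lsmul (a - b) x)) y = 0 := by
      intro y
      have h2 : X.tmul Y (X.lsmul (a - b) x) y = 0 := by
        have h3 := congrArg (fun T : (X.tensor Y).carrier →L[ℂ] (X.tensor Y).carrier =>
          T (X.tmul Y x y)) hab
        simp only [φ_apply, lsmul_tmul] at h3
        have h4 : X.lsmul (a - b) x = X.lsmul a x + (-1 : ℂ) • X.lsmul b x := by
          rw [sub_eq_add_neg, ← neg_one_smul ℂ b, X.add_lsmul, X.smul_lsmul]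
        rw [h4, add_tmul, smul_tmul, h3]
        simp
      refine Y.ext_inner fun z => ?_
      have h5 := X.inner_tmul Y (X.lsmul (a - b) x) (X.lsmul (a - b) x) z y
      rw [h2, ← innerL_apply, map_zero] at h5
      rw [← h5, ← innerL_apply, map_zero]
    have h0 : Y.φ 0 = 0 := by
      ext y
      have := Y.smul_lsmul 0 0 y
      simpa using this
    have h6 : X.inner (X.lsmul (a - b) x) (X.lsmul (a - b) x) = 0 :=
      hY.1 (by rw [h0]; ext y; exact h1 y)
    have h7 := X.norm_sq_eq (X.lsmul (a - b) x)
    rw [h6, norm_zero] at h7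
    have h8 : X.lsmul (a - b) x = 0 := norm_eq_zero.1 (pow_eq_zero_iff two_ne_zero |>.1 h7)
    have h9 : X.lsmul a x = X.lsmul (a - b) x + X.lsmul b x := by
      rw [← X.add_lsmul, sub_add_cancel]
    rw [φ_apply, φ_apply, h9, h8, zero_add]
  · refine (X.tensor Y).isClosed_compacts.closure_subset ?_
    rw [Metric.mem_closure_iff]
    intro ε hε
    have ha : X.φ a ∈ closure
        (Submodule.span ℂ {T | ∃ x y, X.theta x y = T} : Set (X.carrier →L[ℂ] X.carrier)) := hX.2 a
    obtain ⟨F, hF, hFa⟩ := Metric.mem_closure_iff.1 ha ε hε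
    obtain ⟨⟨F', hF'⟩, R, hR, hR'⟩ := exists_span_tensor (Y := Y) hY.2 hF
    refine ⟨R, hR, ?_⟩
    rw [dist_eq_norm] at hFa ⊢
    refine lt_of_le_of_lt (norm_le_of_tmul X Y (S := X.φ a - F) (S' := X.φ (star a) - F')
      (fun x y => ?_) _ (fun x y => ?_)) hFa
    · change X.inner (X.lsmul a x - F x) y = X.inner x (X.lsmul (star a) y - F' y)
      rw [inner_sub_left, inner_sub_right, hF', X.inner_lsmul_left]
    · change (X.tensor Y).lsmul a (X.tmul Y x y) - R (X.tmul Y x y)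
        = X.tmul Y (X.lsmul a x - F x) y
      rw [sub_tmul, hR', lsmul_tmul]

/-- The condition `J_X · M ⊆ M · J_Y` is stable under tensor products. -/
theorem tensor_sub {I : Set A} {J : Set B} {K : Set C} (hX : X.leftSub I ≤ X.rightSub J)
    (hY : Y.leftSub J ≤ Y.rightSub K) : (X.tensor Y).leftSub I ≤ (X.tensor Y).rightSub K := by
  have hcl : IsClosed ((X.tensor Y).rightSub K : Set (X.tensor Y).carrier) :=
    Submodule.isClosed_topologicalClosure _
  have h1 : ∀ m ∈ X.rightSub J, ∀ n, X.tmul Y m n ∈ (X.tensor Y).rightSub K := by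
    intro m hm n
    have h2 : Submodule.span ℂ {z | ∃ b ∈ J, ∃ m, X.rsmul m b = z} ≤
        ((X.tensor Y).rightSub K).comap ((X.tmulL Y).flip n).toLinearMap := by
      rw [Submodule.span_le]
      rintro _ ⟨b, hb, m, rfl⟩
      change X.tmul Y (X.rsmul m b) n ∈ (X.tensor Y).rightSub K
      rw [rsmul_tmul_eq]
      have h3 : Y.lsmul b n ∈ Y.rightSub K :=
        hY (Submodule.le_topologicalClosure _ (Submodule.subset_span ⟨b, hb, n, rfl⟩))
      have h4 : Submodule.span ℂ {z | ∃ b ∈ K, ∃ m, Y.rsmul m b = z} ≤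
          ((X.tensor Y).rightSub K).comap (X.tmulL Y m).toLinearMap := by
        rw [Submodule.span_le]
        rintro _ ⟨c, hc, n, rfl⟩
        exact Submodule.le_topologicalClosure _
          (Submodule.subset_span ⟨c, hc, X.tmul Y m n, X.rsmul_tmul Y m n c⟩)
      exact (hcl.preimage (X.tmulL Y m).continuous).closure_subset_iff.2 h4 h3
    exact (hcl.preimage ((X.tmulL Y).flip n).continuous).closure_subset_iff.2 h2 hm
  refine Submodule.topologicalClosure_minimal _ ?_ hcl
  rw [Submodule.span_le]
  rintro _ ⟨a, ha, z, rfl⟩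
  refine mem_of_gen (Gen.tmul_id X Y) _ hcl ((X.tensor Y).φ a) ?_ z
  rintro _ ⟨p, rfl⟩
  rw [φ_apply, lsmul_tmul]
  exact h1 _ (hX (Submodule.le_topologicalClosure _ (Submodule.subset_span ⟨a, ha, _, rfl⟩))) _

end tensor

theorem one_regular : (one A).IsRegular := by
  refine ⟨fun a b hab => ?_, fun a => ?_⟩
  · have h : ∀ c : A, a * c = b * c := fun c =>
      congrArg (fun T : (one A).carrier →L[ℂ] (one A).carrier => T c) hab
    have h1 : star (star (a - b)) * star (a - b) = 0 := by
      rw [star_star, sub_mul, h, sub_self]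
    exact sub_eq_zero.1 (star_eq_zero.1 ((CStarRing.star_mul_self_eq_zero_iff _).1 h1))
  · refine (one A).isClosed_compacts.closure_subset ?_
    rw [Metric.mem_closure_iff]
    intro ε hε
    obtain ⟨e, -, h, -⟩ := exists_approx a hε
    have key : ∀ c : A, ‖((one A).φ a - (one A).theta a (star e : A)) c‖ ≤ ‖a - a * e‖ * ‖c‖ := by
      intro c
      have e1 : a * c - a * (star (star e) * c) = (a - a * e) * c := by
        rw [star_star, sub_mul, mul_assoc]
      exact (congrArg norm e1).trans_le (norm_mul_le (a - a * e) c)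
    refine ⟨(one A).theta a (star e : A), theta_mem _ _ _, ?_⟩
    rw [dist_eq_norm]
    exact (ContinuousLinearMap.opNorm_le_bound _ (norm_nonneg (a - a * e)) key).trans_lt h

/-- The Katsura ideal is closed under right multiplication. -/
theorem mul_mem_katsuraIdeal (X : Corr A A) {a : A} (ha : a ∈ X.katsuraIdeal) (c : A) :
    a * c ∈ X.katsuraIdeal := by
  refine ⟨?_, fun b hb => ?_⟩
  · have e : X.φ (a * c) =
        (ContinuousLinearMap.compL ℂ _ _ _).flip (X.φ c) (X.φ a) := by
      ext x; exact X.mul_lsmul _ _ _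
    rw [e]
    have h1 : Submodule.span ℂ {T | ∃ x y, X.theta x y = T} ≤ X.compacts.comap
        ((ContinuousLinearMap.compL ℂ X.carrier X.carrier X.carrier).flip
          (X.φ c)).toLinearMap := by
      rw [Submodule.span_le]
      rintro _ ⟨x, y, rfl⟩
      change (X.theta x y).comp (X.φ c) ∈ X.compacts
      have e2 : (X.theta x y).comp (X.φ c) = X.theta x (X.lsmul (star c) y) := by
        ext z
        change X.rsmul x (X.inner y (X.lsmul c z)) = X.rsmul x _
        rw [X.inner_lsmul_right]
      rw [e2]
      exact X.theta_mem _ _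
    exact (X.isClosed_compacts.preimage (ContinuousLinearMap.continuous
      ((ContinuousLinearMap.compL ℂ X.carrier X.carrier X.carrier).flip
        (X.φ c)))).closure_subset_iff.2 h1 ha.1
  · rw [mul_assoc]
    refine ha.2 _ ?_
    ext x
    rw [φ_apply, X.mul_lsmul, ← φ_apply X b, hb]
    change X.φ c 0 = 0
    rw [map_zero]

theorem one_sub (X : Corr A A) :
    (one A).leftSub X.katsuraIdeal ≤ (one A).rightSub X.katsuraIdeal := by
  have hcl : IsClosed ((one A).rightSub X.katsuraIdeal : Set (one A).carrier) :=
    Submodule.isClosed_topologicalClosure _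
  have key : ∀ a ∈ X.katsuraIdeal, ∀ c : A,
      (one A).lsmul a c ∈ (one A).rightSub X.katsuraIdeal := by
    intro a ha c
    refine hcl.closure_subset ?_
    rw [Metric.mem_closure_iff]
    intro ε hε
    obtain ⟨e, -, -, h⟩ := exists_approx (a * c) hε
    refine ⟨(one A).rsmul e (a * c), Submodule.le_topologicalClosure _
      (Submodule.subset_span ⟨_, X.mul_mem_katsuraIdeal ha c, e, rfl⟩), ?_⟩
    exact (dist_eq_norm (a * c) (e * (a * c))).trans_lt h
  refine Submodule.topologicalClosure_minimal _ ?_ hcl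
  rw [Submodule.span_le]
  rintro _ ⟨a, ha, c, rfl⟩
  exact key a ha c

end Corr

/-! ### Diagram chasing on elementary tensors -/

namespace Corr

/-- A map between normed spaces that is linear and continuous. -/
def Lin {E F : Type*} [NormedAddCommGroup E] [NormedSpace ℂ E] [NormedAddCommGroup F]
    [NormedSpace ℂ F] (f : E → F) : Prop := ∃ L : E →L[ℂ] F, ∀ x, L x = f x

section lin

variable {X : Corr A B} {Y : Corr B C}

theorem Lin.iso {E : Type*} [NormedAddCommGroup E] [NormedSpace ℂ E] {Z W : Corr A B}
    (g : CorrIso Z W) {f : E → Z.carrier} (hf : Lin f) : Lin fun x => g (f x) := by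
  obtain ⟨L, hL⟩ := hf
  exact ⟨g.toCLM.comp L, fun x => congrArg g (hL x)⟩

theorem Lin.tmul_left {E : Type*} [NormedAddCommGroup E] [NormedSpace ℂ E] {f : E → X.carrier}
    (hf : Lin f) (y : Y.carrier) : Lin fun t => X.tmul Y (f t) y := by
  obtain ⟨L, hL⟩ := hf
  exact ⟨((X.tmulL Y).flip y).comp L, fun t => congrArg (fun s => X.tmul Y s y) (hL t)⟩

theorem Lin.tmul_right {E : Type*} [NormedAddCommGroup E] [NormedSpace ℂ E] {f : E → Y.carrier}
    (x : X.carrier) (hf : Lin f) : Lin fun t => X.tmul Y x (f t) := by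
  obtain ⟨L, hL⟩ := hf
  exact ⟨(X.tmulL Y x).comp L, fun t => congrArg (X.tmul Y x) (hL t)⟩

theorem Lin.id {E : Type*} [NormedAddCommGroup E] [NormedSpace ℂ E] : Lin fun x : E => x :=
  ⟨ContinuousLinearMap.id ℂ E, fun _ => rfl⟩

theorem Lin.lsmul (a : A) : Lin (X.lsmul a) := ⟨X.φ a, fun _ => rfl⟩

theorem Lin.rsmul (b : B) : Lin fun x => X.rsmul x b := ⟨X.ρ b, fun _ => rfl⟩

theorem Lin.ext {E : Type*} [NormedAddCommGroup E] [NormedSpace ℂ E]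
    {f g : (X.tensor Y).carrier → E} (hf : Lin f) (hg : Lin g)
    (h : ∀ x y, f (X.tmul Y x y) = g (X.tmul Y x y)) (t : (X.tensor Y).carrier) : f t = g t := by
  obtain ⟨F, hF⟩ := hf
  obtain ⟨G, hG⟩ := hg
  have e : F = G := X.tensor_clm_ext Y fun x y => by rw [hF, hG, h]
  rw [← hF, ← hG, e]

theorem iso_ext {Z : Corr A C} {f g : CorrIso (X.tensor Y) Z}
    (h : ∀ x y, f (X.tmul Y x y) = g (X.tmul Y x y)) : f = g :=
  CorrIso.ext (Lin.ext (Lin.iso f Lin.id) (Lin.iso g Lin.id) h)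

end lin

section comp

/-- `(M ⊗ Y) ⊗ N ≅ M ⊗ (Y ⊗ N) ≅ M ⊗ (N ⊗ Z) ≅ (M ⊗ N) ⊗ Z`, by means of
`V : Y ⊗ N ≅ N ⊗ Z`. -/
noncomputable def compR (M : Corr A B) {Y : Corr B B} {N : Corr B C} {Z : Corr C C}
    (V : CorrIso (Y.tensor N) (N.tensor Z)) :
    CorrIso ((M.tensor Y).tensor N) ((M.tensor N).tensor Z) :=
  (assoc M Y N).trans ((tensorIso (CorrIso.refl M) V).trans (assoc M N Z).symm)

/-- The isomorphism `(1_M ⊗ V)(U ⊗ 1_N) : X ⊗ (M ⊗ N) ≅ (M ⊗ N) ⊗ Z`, for `U : X ⊗ M ≅ M ⊗ Y` and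
`V : Y ⊗ N ≅ N ⊗ Z`, with the associativity isomorphisms written out. -/
noncomputable def compU {X : Corr A A} {M : Corr A B} {Y : Corr B B} {N : Corr B C}
    {Z : Corr C C} (U : CorrIso (X.tensor M) (M.tensor Y))
    (V : CorrIso (Y.tensor N) (N.tensor Z)) :
    CorrIso (X.tensor (M.tensor N)) ((M.tensor N).tensor Z) :=
  (assoc X M N).symm.trans ((tensorIso U (CorrIso.refl N)).trans (compR M V))

theorem compR_tmul (M : Corr A B) {Y : Corr B B} {N : Corr B C} {Z : Corr C C}
    (V : CorrIso (Y.tensor N) (N.tensor Z)) (m : M.carrier) (y : Y.carrier) (n : N.carrier) :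
    compR M V ((M.tensor Y).tmul N (M.tmul Y m y) n)
      = (assoc M N Z).symm (M.tmul (N.tensor Z) m (V (Y.tmul N y n))) := by
  simp only [compR, CorrIso.trans_apply, assoc_tmul, tensorIso_tmul, CorrIso.refl_apply]

theorem compU_tmul {X : Corr A A} {M : Corr A B} {Y : Corr B B} {N : Corr B C}
    {Z : Corr C C} (U : CorrIso (X.tensor M) (M.tensor Y))
    (V : CorrIso (Y.tensor N) (N.tensor Z)) (x : X.carrier) (m : M.carrier) (n : N.carrier) :
    compU U V (X.tmul (M.tensor N) x (M.tmul N m n))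
      = compR M V ((M.tensor Y).tmul N (U (X.tmul M x m)) n) := by
  simp only [compU, CorrIso.trans_apply, assoc_symm_tmul, tensorIso_tmul, CorrIso.refl_apply]

theorem compU_ext {X : Corr A A} {M : Corr A B} {N : Corr B C} {Z : Corr A C}
    {f g : CorrIso (X.tensor (M.tensor N)) Z}
    (h : ∀ x m n, f (X.tmul _ x (M.tmul N m n)) = g (X.tmul _ x (M.tmul N m n))) : f = g :=
  iso_ext fun x s => Lin.ext (f := fun s => f (X.tmul _ x s)) (g := fun s => g (X.tmul _ x s))
    (Lin.iso f (Lin.tmul_right x Lin.id)) (Lin.iso g (Lin.tmul_right x Lin.id)) (h x) s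

end comp

/-- The isomorphism `X ⊗ A ≅ X ≅ A ⊗ X`, the inverse of `a ⊗ x ↦ a · x` after
`x ⊗ a ↦ x · a`. -/
noncomputable def unitU (X : Corr A A) : CorrIso (X.tensor (one A)) ((one A).tensor X) :=
  (rightUnit X).trans (leftUnit X).symm

/-- `(M, U)` and `(N, V)` are isomorphic: there is an isomorphism `ξ : M ≅ N` with
`(ξ ⊗ 1) U = V (1 ⊗ ξ)`. -/
def Intertwine {X : Corr A A} {Y : Corr B B} {M N : Corr A B}
    (U : CorrIso (X.tensor M) (M.tensor Y)) (V : CorrIso (X.tensor N) (N.tensor Y)) : Prop :=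
  ∃ ξ : CorrIso M N, U.trans (tensorIso ξ (CorrIso.refl Y))
    = (tensorIso (CorrIso.refl X) ξ).trans V

section equivalence

variable {X : Corr A A} {Y : Corr B B} {M N K : Corr A B} {U : CorrIso (X.tensor M) (M.tensor Y)}
  {V : CorrIso (X.tensor N) (N.tensor Y)} {S : CorrIso (X.tensor K) (K.tensor Y)}

theorem intertwine_iff : Intertwine U V ↔ ∃ ξ : CorrIso M N, ∀ x m,
    tensorIso ξ (CorrIso.refl Y) (U (X.tmul M x m)) = V (X.tmul N x (ξ m)) := by
  refine exists_congr fun ξ => ⟨fun h x m => ?_, fun h => ?_⟩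
  · have := congrArg (fun f : CorrIso _ _ => f (X.tmul M x m)) h
    simpa only [CorrIso.trans_apply, tensorIso_tmul, CorrIso.refl_apply] using this
  · refine iso_ext fun x m => ?_
    simpa only [CorrIso.trans_apply, tensorIso_tmul, CorrIso.refl_apply] using h x m

theorem intertwine_refl (U : CorrIso (X.tensor M) (M.tensor Y)) : Intertwine U U := by
  refine intertwine_iff.2 ⟨CorrIso.refl _, fun x m => ?_⟩
  have h : tensorIso (CorrIso.refl M) (CorrIso.refl Y) = CorrIso.refl _ :=
    iso_ext fun m y => tensorIso_tmul _ _ m y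
  rw [h]
  rfl

theorem intertwine_symm (h : Intertwine U V) : Intertwine V U := by
  obtain ⟨ξ, h⟩ := intertwine_iff.1 h
  refine intertwine_iff.2 ⟨ξ.symm, fun x m => ?_⟩
  obtain ⟨m, rfl⟩ := ξ.toEquiv.surjective m
  rw [← h, CorrIso.symm_apply_apply]
  exact Lin.ext (f := fun t => tensorIso ξ.symm (CorrIso.refl Y) (tensorIso ξ (CorrIso.refl Y) t))
    (Lin.iso _ (Lin.iso _ Lin.id)) Lin.id
    (fun m y => by simp only [tensorIso_tmul, CorrIso.symm_apply_apply, CorrIso.refl_apply]) _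

theorem intertwine_trans (h : Intertwine U V) (h' : Intertwine V S) : Intertwine U S := by
  obtain ⟨ξ, h⟩ := intertwine_iff.1 h
  obtain ⟨η, h'⟩ := intertwine_iff.1 h'
  refine intertwine_iff.2 ⟨ξ.trans η, fun x m => ?_⟩
  rw [CorrIso.trans_apply, ← h', ← h]
  exact Lin.ext (g := fun t => tensorIso η (CorrIso.refl Y) (tensorIso ξ (CorrIso.refl Y) t))
    (Lin.iso _ Lin.id) (Lin.iso _ (Lin.iso _ Lin.id))
    (fun m y => by simp only [tensorIso_tmul, CorrIso.trans_apply, CorrIso.refl_apply]) _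

end equivalence

section diagrams

variable {X : Corr A A} {Y : Corr B B} {Z : Corr C C} {W : Corr D D} {M M' : Corr A B}
  {N N' : Corr B C} {K : Corr C D}

theorem compU_intertwine {U : CorrIso (X.tensor M) (M.tensor Y)}
    {U' : CorrIso (X.tensor M') (M'.tensor Y)} {V : CorrIso (Y.tensor N) (N.tensor Z)}
    {V' : CorrIso (Y.tensor N') (N'.tensor Z)} (hP : Intertwine U U') (hQ : Intertwine V V') :
    Intertwine (compU U V) (compU U' V') := by
  obtain ⟨ξ, hξ⟩ := intertwine_iff.1 hP
  obtain ⟨η, hη⟩ := intertwine_iff.1 hQ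
  refine ⟨tensorIso ξ η, compU_ext fun x m n => ?_⟩
  change tensorIso (tensorIso ξ η) (CorrIso.refl Z) (compU U V (X.tmul _ x (M.tmul N m n)))
    = compU U' V' (tensorIso (CorrIso.refl X) (tensorIso ξ η) (X.tmul _ x (M.tmul N m n)))
  rw [compU_tmul, tensorIso_tmul, tensorIso_tmul, CorrIso.refl_apply, compU_tmul, ← hξ]
  refine Lin.ext (X := M) (Y := Y)
    (f := fun t => tensorIso (tensorIso ξ η) (CorrIso.refl Z)
      (compR M V ((M.tensor Y).tmul N t n)))
    (g := fun t => compR M' V' ((M'.tensor Y).tmul N'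
      (tensorIso ξ (CorrIso.refl Y) t) (η n)))
    (Lin.iso _ (Lin.iso _ (Lin.tmul_left Lin.id _)))
    (Lin.iso _ (Lin.tmul_left (Lin.iso _ Lin.id) _)) (fun m y => ?_) _
  simp only [compR_tmul, tensorIso_tmul, CorrIso.refl_apply]
  rw [← hη]
  refine Lin.ext (X := N) (Y := Z)
    (f := fun s => tensorIso (tensorIso ξ η) (CorrIso.refl Z)
      ((assoc M N Z).symm (M.tmul (N.tensor Z) m s)))
    (g := fun s => (assoc M' N' Z).symm (M'.tmul (N'.tensor Z) (ξ m)
      (tensorIso η (CorrIso.refl Z) s)))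
    (Lin.iso _ (Lin.iso _ (Lin.tmul_right _ Lin.id)))
    (Lin.iso _ (Lin.tmul_right _ (Lin.iso _ Lin.id))) (fun n z => ?_) _
  simp only [assoc_symm_tmul, tensorIso_tmul, CorrIso.refl_apply]

theorem compU_assoc (U : CorrIso (X.tensor M) (M.tensor Y)) (V : CorrIso (Y.tensor N) (N.tensor Z))
    (S : CorrIso (Z.tensor K) (K.tensor W)) :
    Intertwine (compU (compU U V) S) (compU U (compU V S)) := by
  refine ⟨assoc M N K, iso_ext fun x s => ?_⟩
  change tensorIso (assoc M N K) _ (compU (compU U V) S _)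
    = compU U (compU V S) (tensorIso _ (assoc M N K) _)
  rw [tensorIso_tmul, CorrIso.refl_apply]
  refine Lin.ext (X := M.tensor N) (Y := K)
    (f := fun s => tensorIso (assoc M N K) (CorrIso.refl W)
      (compU (compU U V) S (X.tmul _ x s)))
    (g := fun s => compU U (compU V S) (X.tmul _ x (assoc M N K s)))
    (Lin.iso _ (Lin.iso _ (Lin.tmul_right _ Lin.id)))
    (Lin.iso _ (Lin.tmul_right _ (Lin.iso _ Lin.id))) (fun s k => ?_) _
  refine Lin.ext (X := M) (Y := N)
    (f := fun s => tensorIso (assoc M N K) (CorrIso.refl W)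
      (compU (compU U V) S (X.tmul _ x ((M.tensor N).tmul K s k))))
    (g := fun s => compU U (compU V S)
      (X.tmul _ x (assoc M N K ((M.tensor N).tmul K s k))))
    (Lin.iso _ (Lin.iso _ (Lin.tmul_right _ (Lin.tmul_left Lin.id _))))
    (Lin.iso _ (Lin.tmul_right _ (Lin.iso _ (Lin.tmul_left Lin.id _)))) (fun m n => ?_) _
  simp only [assoc_tmul, compU_tmul]
  refine Lin.ext (X := M) (Y := Y)
    (f := fun t => tensorIso (assoc M N K) (CorrIso.refl W)
      (compR (M.tensor N) S (((M.tensor N).tensor Z).tmul K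
        (compR M V ((M.tensor Y).tmul N t n)) k)))
    (g := fun t => compR M (compU V S)
      ((M.tensor Y).tmul (N.tensor K) t (N.tmul K n k)))
    (Lin.iso _ (Lin.iso _ (Lin.tmul_left (Lin.iso _ (Lin.tmul_left Lin.id _)) _)))
    (Lin.iso _ (Lin.tmul_left Lin.id _)) (fun m y => ?_) _
  simp only [compR_tmul, compU_tmul]
  refine Lin.ext (X := N) (Y := Z)
    (f := fun s => tensorIso (assoc M N K) (CorrIso.refl W)
      (compR (M.tensor N) S (((M.tensor N).tensor Z).tmul K
        ((assoc M N Z).symm (M.tmul (N.tensor Z) m s)) k)))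
    (g := fun s => (assoc M (N.tensor K) W).symm
      (M.tmul ((N.tensor K).tensor W) m
        (compR N S ((N.tensor Z).tmul K s k))))
    (Lin.iso _ (Lin.iso _ (Lin.tmul_left (Lin.iso _ (Lin.tmul_right _ Lin.id)) _)))
    (Lin.iso _ (Lin.tmul_right _ (Lin.iso _ (Lin.tmul_left Lin.id _)))) (fun n z => ?_) _
  simp only [compR_tmul, assoc_symm_tmul]
  refine Lin.ext (X := K) (Y := W)
    (f := fun r => tensorIso (assoc M N K) (CorrIso.refl W)
      ((assoc (M.tensor N) K W).symm
        ((M.tensor N).tmul (K.tensor W) (M.tmul N m n) r)))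
    (g := fun r => (assoc M (N.tensor K) W).symm
      (M.tmul ((N.tensor K).tensor W) m
        ((assoc N K W).symm (N.tmul (K.tensor W) n r))))
    (Lin.iso _ (Lin.iso _ (Lin.tmul_right _ Lin.id)))
    (Lin.iso _ (Lin.tmul_right _ (Lin.iso _ (Lin.tmul_right _ Lin.id)))) (fun k w => ?_) _
  simp only [assoc_symm_tmul, assoc_tmul, tensorIso_tmul, CorrIso.refl_apply]

theorem unitU_tmul (X : Corr A A) (x : X.carrier) (a : A) :
    unitU X (X.tmul (one A) x a) = (leftUnit X).symm (X.rsmul x a) :=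
  congrArg (leftUnit X).symm (rightUnit_tmul X x a)

theorem leftUnit_assoc (M : Corr A B) (Y : Corr B B) (a : A) (s : (M.tensor Y).carrier) :
    tensorIso (leftUnit M) (CorrIso.refl Y)
      ((assoc (one A) M Y).symm ((one A).tmul (M.tensor Y) a s)) = (M.tensor Y).lsmul a s := by
  refine Lin.ext (X := M) (Y := Y)
    (f := fun s => tensorIso (leftUnit M) (CorrIso.refl Y)
      ((assoc (one A) M Y).symm ((one A).tmul (M.tensor Y) a s)))
    (g := (M.tensor Y).lsmul a)
    (Lin.iso _ (Lin.iso _ (Lin.tmul_right _ Lin.id))) (Lin.lsmul _) (fun m y => ?_) _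
  rw [lsmul_tmul, ← leftUnit_tmul]
  exact (congrArg _ (assoc_symm_tmul _ _ _ _ _ _)).trans (tensorIso_tmul _ _ _ _)

theorem leftUnit_compR (U : CorrIso (X.tensor M) (M.tensor Y)) (m : M.carrier)
    (t : ((one A).tensor X).carrier) : tensorIso (leftUnit M) (CorrIso.refl Y)
      (compR (one A) U (((one A).tensor X).tmul M t m)) = U (X.tmul M (leftUnit X t) m) := by
  have key : ∀ (a : A) (x : X.carrier), tensorIso (leftUnit M) (CorrIso.refl Y)
      (compR (one A) U (((one A).tensor X).tmul M ((one A).tmul X a x) m))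
      = U (X.tmul M (leftUnit X ((one A).tmul X a x)) m) := fun a x => by
    refine (congrArg _ (compR_tmul _ _ _ _ _)).trans ((leftUnit_assoc M Y a _).trans ?_)
    rw [← U.map_lsmul, lsmul_tmul, ← leftUnit_tmul]
  exact Lin.ext (f := fun t => tensorIso (leftUnit M) (CorrIso.refl Y)
      (compR (one A) U (((one A).tensor X).tmul M t m)))
    (g := fun t => U (X.tmul M (leftUnit X t) m))
    (Lin.iso _ (Lin.iso _ (Lin.tmul_left Lin.id _)))
    (Lin.iso _ (Lin.tmul_left (Lin.iso _ Lin.id) _)) key t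

theorem unitU_compU (U : CorrIso (X.tensor M) (M.tensor Y)) :
    Intertwine (compU (unitU X) U) U := by
  have key : ∀ (x : X.carrier) (a : A) (m : M.carrier),
      tensorIso (leftUnit M) (CorrIso.refl Y)
        (compU (unitU X) U (X.tmul _ x ((one A).tmul M a m)))
      = U (tensorIso (CorrIso.refl X) (leftUnit M) (X.tmul _ x ((one A).tmul M a m))) :=
    fun x a m => by
    refine (congrArg _ (compU_tmul _ _ _ _ _)).trans ((leftUnit_compR U m _).trans ?_)
    rw [unitU_tmul, CorrIso.apply_symm_apply, rsmul_tmul_eq, ← leftUnit_tmul]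
    exact congrArg U (tensorIso_tmul (CorrIso.refl X) (leftUnit M) x _).symm
  exact ⟨leftUnit M, compU_ext key⟩

theorem rightUnit_assoc (M : Corr A B) (Y : Corr B B) (m : M.carrier)
    (s : ((one B).tensor Y).carrier) : tensorIso (rightUnit M) (CorrIso.refl Y)
      ((assoc M (one B) Y).symm (M.tmul ((one B).tensor Y) m s))
      = M.tmul Y m (leftUnit Y s) := by
  have key : ∀ (b : B) (y : Y.carrier), tensorIso (rightUnit M) (CorrIso.refl Y)
      ((assoc M (one B) Y).symm (M.tmul ((one B).tensor Y) m ((one B).tmul Y b y)))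
      = M.tmul Y m (leftUnit Y ((one B).tmul Y b y)) := fun b y => by
    rw [leftUnit_tmul, ← rsmul_tmul_eq, ← rightUnit_tmul]
    exact (congrArg _ (assoc_symm_tmul _ _ _ _ _ _)).trans (tensorIso_tmul _ _ _ _)
  exact Lin.ext (f := fun s => tensorIso (rightUnit M) (CorrIso.refl Y)
      ((assoc M (one B) Y).symm (M.tmul ((one B).tensor Y) m s)))
    (g := fun s => M.tmul Y m (leftUnit Y s))
    (Lin.iso _ (Lin.iso _ (Lin.tmul_right _ Lin.id))) (Lin.tmul_right _ (Lin.iso _ Lin.id)) key s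

theorem rightUnit_compR (M : Corr A B) (Y : Corr B B) (b : B) (t : (M.tensor Y).carrier) :
    tensorIso (rightUnit M) (CorrIso.refl Y)
      (compR M (unitU Y) ((M.tensor Y).tmul (one B) t b)) = (M.tensor Y).rsmul t b := by
  have key : ∀ (m : M.carrier) (y : Y.carrier), tensorIso (rightUnit M) (CorrIso.refl Y)
      (compR M (unitU Y) ((M.tensor Y).tmul (one B) (M.tmul Y m y) b))
      = (M.tensor Y).rsmul (M.tmul Y m y) b := fun m y => by
    refine (congrArg _ (compR_tmul _ _ _ _ _)).trans ((rightUnit_assoc M Y m _).trans ?_)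
    rw [unitU_tmul, CorrIso.apply_symm_apply, rsmul_tmul]
  exact Lin.ext (f := fun t => tensorIso (rightUnit M) (CorrIso.refl Y)
      (compR M (unitU Y) ((M.tensor Y).tmul (one B) t b)))
    (g := fun t => (M.tensor Y).rsmul t b)
    (Lin.iso _ (Lin.iso _ (Lin.tmul_left Lin.id _))) (Lin.rsmul b) key t

theorem compU_unitU (U : CorrIso (X.tensor M) (M.tensor Y)) :
    Intertwine (compU U (unitU Y)) U := by
  have key : ∀ (x : X.carrier) (m : M.carrier) (b : B),
      tensorIso (rightUnit M) (CorrIso.refl Y)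
        (compU U (unitU Y) (X.tmul _ x (M.tmul (one B) m b)))
      = U (tensorIso (CorrIso.refl X) (rightUnit M) (X.tmul _ x (M.tmul (one B) m b))) :=
    fun x m b => by
    refine (congrArg _ (compU_tmul _ _ _ _ _)).trans ((rightUnit_compR M Y b _).trans ?_)
    rw [← U.map_rsmul, rsmul_tmul, ← rightUnit_tmul]
    exact congrArg U (tensorIso_tmul (CorrIso.refl X) (rightUnit M) x _).symm
  exact ⟨rightUnit M, compU_ext key⟩

end diagrams

end Corr

open CategoryTheory

/-! ### The category `ECCor` -/

/-- An object of `ECCor`: a C*-algebra `A` with a C*-correspondence `X` over `A`. -/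
structure ECCor : Type (u + 1) where
  A : Type u
  [algebra : NonUnitalCStarAlgebra A]
  X : Corr A A

attribute [instance] ECCor.algebra

/-- A pair `(M, U)` representing a morphism `X ⟶ Y`: a regular correspondence `M` with
`J_X · M ⊆ M · J_Y` and an isomorphism `U : X ⊗ M ≅ M ⊗ Y`. -/
structure ECPair (X Y : ECCor.{u}) : Type (u + 1) where
  M : Corr X.A Y.A
  U : CorrIso (X.X.tensor M) (M.tensor Y.X)
  regular : M.IsRegular
  katsura : M.leftSub X.X.katsuraIdeal ≤ M.rightSub Y.X.katsuraIdeal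

namespace ECPair

open Corr

variable {X Y Z W : ECCor.{u}}

/-- Isomorphism of pairs. -/
def Rel (P Q : ECPair X Y) : Prop :=
  Intertwine P.U Q.U

theorem Rel.refl (P : ECPair X Y) : P.Rel P := intertwine_refl P.U

theorem Rel.symm {P Q : ECPair X Y} : P.Rel Q → Q.Rel P := intertwine_symm

theorem Rel.trans {P Q R : ECPair X Y} : P.Rel Q → Q.Rel R → P.Rel R := intertwine_trans

instance setoid (X Y : ECCor.{u}) : Setoid (ECPair X Y) :=
  ⟨Rel, Rel.refl, Rel.symm, Rel.trans⟩

/-- The pair `(A, X ⊗ A ≅ X ≅ A ⊗ X)` representing the identity of `X`. -/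
noncomputable def id (X : ECCor.{u}) : ECPair X X where
  M := one X.A
  U := unitU X.X
  regular := one_regular
  katsura := one_sub X.X

/-- The composite `(M ⊗ N, (1 ⊗ V)(U ⊗ 1))` of `(M, U)` and `(N, V)`. -/
noncomputable def comp (P : ECPair X Y) (Q : ECPair Y Z) : ECPair X Z where
  M := P.M.tensor Q.M
  U := compU P.U Q.U
  regular := tensor_regular P.regular Q.regular
  katsura := tensor_sub P.katsura Q.katsura

theorem comp_rel {P P' : ECPair X Y} {Q Q' : ECPair Y Z} (hP : P.Rel P') (hQ : Q.Rel Q') :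
    (P.comp Q).Rel (P'.comp Q') := compU_intertwine hP hQ

theorem comp_assoc (P : ECPair X Y) (Q : ECPair Y Z) (R : ECPair Z W) :
    ((P.comp Q).comp R).Rel (P.comp (Q.comp R)) := compU_assoc P.U Q.U R.U

theorem id_comp (P : ECPair X Y) : ((id X).comp P).Rel P := unitU_compU P.U

theorem comp_id (P : ECPair X Y) : (P.comp (id Y)).Rel P := compU_unitU P.U

end ECPair

/-- The category `ECCor`: its morphisms are isomorphism classes of pairs `(M, U)`. -/
noncomputable instance : Category.{u + 1} ECCor.{u} where
  Hom X Y := Quotient (ECPair.setoid X Y)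
  id X := Quotient.mk _ (ECPair.id X)
  comp f g := Quotient.map₂ ECPair.comp (fun _ _ hP _ _ hQ => ECPair.comp_rel hP hQ) f g
  id_comp f := Quotient.inductionOn f fun P => Quotient.sound P.id_comp
  comp_id f := Quotient.inductionOn f fun P => Quotient.sound P.comp_id
  assoc f g h := Quotient.inductionOn₃ f g h fun P Q R => Quotient.sound (P.comp_assoc Q R)

/-- The morphism `[M, U]` of `ECCor` represented by a pair `(M, U)`. -/
def ECCor.homMk {X Y : ECCor.{u}} (P : ECPair X Y) : X ⟶ Y :=
  Quotient.mk (ECPair.setoid X Y) P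

/-! ### Imprimitivity bimodules and Morita equivalence -/

/-- An `A`-valued inner product turning a correspondence into a Hilbert `A`-`B` bimodule. -/
structure LeftInner (M : Corr A B) where
  linner : M.carrier → M.carrier → A
  add_left : ∀ x y z, linner (x + y) z = linner x z + linner y z
  smul_left : ∀ (c : ℂ) x y, linner (c • x) y = c • linner x y
  lsmul_left : ∀ a x y, linner (M.lsmul a x) y = a * linner x y
  star_linner : ∀ x y, star (linner x y) = linner y x
  nonneg : ∀ x, 0 ≤ linner x x
  definite : ∀ x, linner x x = 0 → x = 0
  compat : ∀ x y z, M.lsmul (linner x y) z = M.rsmul x (M.inner y z)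

/-- `M` is an imprimitivity bimodule: a Hilbert bimodule that is full on both sides. -/
def Corr.IsImprimitivity (M : Corr A B) : Prop :=
  ∃ L : LeftInner M,
    Dense (Submodule.span ℂ {a | ∃ x y, L.linner x y = a} : Set A) ∧
    Dense (Submodule.span ℂ {b | ∃ x y, M.inner x y = b} : Set B)

/-- Correspondences `X` over `A` and `Y` over `B` are Morita equivalent if there is an `A`-`B`
imprimitivity bimodule `M` with `X ⊗_A M ≅ M ⊗_B Y`. -/
def MoritaEquivalent (X : Corr A A) (Y : Corr B B) : Prop :=
  ∃ M : Corr A B, M.IsImprimitivity ∧ Nonempty (CorrIso (X.tensor M) (M.tensor Y))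

end CStarCorr

/-!
A morphism `[M, U]` of `ECCor` is invertible exactly when `M` is invertible up to isomorphism for the
balanced tensor product, and the latter property characterises imprimitivity bimodules.

Suppose `M ⊗ N ≅ A` and `N ⊗ M ≅ B` with `M` and `N` regular.  For `x, y` in `M` the operator
`θ_{x,y} ⊗ 1` is compact on `M ⊗ N ≅ A`, so it is left multiplication by an element of `A`
(`exists_φ_one_eq`); since `B` acts faithfully on `N`, that element already acts on `M` as `θ_{x,y}`
(`exists_φ_eq_theta`), and it is declared to be `⟪x, y⟫_A` (`exists_leftInner`).  Its values are
dense because `φ_M` is bounded below and takes compact values, and the right inner product is full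
because the inner product of `N ⊗ M ≅ B` takes its values in the closed span of `⟪M, M⟫_B`
(`isImprimitivity_of_inverse`).

Conversely let `M` be an imprimitivity bimodule and `U : X ⊗ M ≅ M ⊗ Y`.  The dual bimodule `M*`
satisfies `M ⊗ M* ≅ A` through the left inner product (`Full.counit`).  Tensoring with `M` is full on
isomorphisms (`exists_tensorIso_refl_eq`), so there is `V : Y ⊗ M* ≅ M* ⊗ X` making `(M*, V)` a right
inverse of `(M, U)` (`exists_comp_rel_id`).  As `M*` is again an imprimitivity bimodule, it has a
right inverse too, which forces the right inverse to be two-sided.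

An imprimitivity bimodule is regular, and `X ⊗ M ≅ M ⊗ Y` implies `⟪M, J_X M⟫ ⊆ J_Y`, hence
`J_X M ⊆ M J_Y` (`Full.leftSub_le_rightSub`).  So a Morita equivalence always defines a morphism of
`ECCor`, and the second assertion follows from the first.
-/

/-! ### Compact operators and faithful actions -/

namespace CStarCorr

attribute [local instance] CStarAlgebra.spectralOrder CStarAlgebra.spectralOrderedRing

variable {A B C : Type u} [NonUnitalCStarAlgebra A] [NonUnitalCStarAlgebra B]
  [NonUnitalCStarAlgebra C]

theorem HilbertModule.eq_zero_of_inner_self (X : HilbertModule B) {x : X.carrier}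
    (h : X.inner x x = 0) : x = 0 := by
  have h1 := X.norm_sq_eq x
  rw [h, norm_zero] at h1
  exact norm_eq_zero.1 (pow_eq_zero_iff two_ne_zero |>.1 h1)

namespace Corr

/-- The left action `φ_X`, as a bounded linear map on the coefficient algebra. -/
noncomputable def φL (X : Corr A B) : A →L[ℂ] (X.carrier →L[ℂ] X.carrier) :=
  LinearMap.mkContinuous
    ⟨⟨X.φ, fun a b => by ext x; exact X.add_lsmul a b x⟩,
      fun c a => by ext x; exact X.smul_lsmul c a x⟩ 1
    (fun a => by
      rw [one_mul]
      exact LinearMap.mkContinuous_norm_le _ (norm_nonneg a) (X.norm_lsmul_le a))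

@[simp] theorem φL_apply (X : Corr A B) (a : A) : X.φL a = X.φ a := rfl

theorem zero_lsmul (X : Corr A B) (x : X.carrier) : X.lsmul 0 x = 0 := by
  rw [← φ_apply, ← φL_apply, map_zero]; rfl

theorem injective_φ_of_lsmul_eq_zero {X : Corr A B}
    (h : ∀ a, (∀ x, X.lsmul a x = 0) → a = 0) : Function.Injective X.φ := by
  refine (injective_iff_map_eq_zero X.φL).2 fun a ha => h a fun x => ?_
  rw [← φ_apply, ← φL_apply, ha]; rfl

theorem eq_of_lsmul_eq {X : Corr A B} (hX : Function.Injective X.φ) {a b : A}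
    (h : ∀ x, X.lsmul a x = X.lsmul b x) : a = b :=
  hX (ContinuousLinearMap.ext h)

/-- If `Y` is faithful, then `x ↦ x ⊗ ·` is injective. -/
theorem eq_of_tmul_eq {X : Corr A B} {Y : Corr B C} (hY : Function.Injective Y.φ)
    {u v : X.carrier} (h : ∀ y, X.tmul Y u y = X.tmul Y v y) : u = v := by
  refine sub_eq_zero.1 (X.eq_zero_of_inner_self (eq_of_lsmul_eq hY fun y => ?_))
  rw [zero_lsmul]
  refine Y.ext_inner fun z => ?_
  rw [← inner_tmul, sub_tmul, sub_tmul, h y, sub_self, inner_zero_right, inner_zero_right]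

/-- A bounded linear map carrying rank-one operators to compact operators preserves
compactness. -/
theorem map_mem_compacts {A' B' : Type u} [NonUnitalCStarAlgebra A'] [NonUnitalCStarAlgebra B']
    {X : Corr A B} {Y : Corr A' B'}
    (Φ : (X.carrier →L[ℂ] X.carrier) →L[ℂ] (Y.carrier →L[ℂ] Y.carrier))
    (h : ∀ x y, Φ (X.theta x y) ∈ Y.compacts) {T : X.carrier →L[ℂ] X.carrier}
    (hT : T ∈ X.compacts) : Φ T ∈ Y.compacts := by
  have h1 : Submodule.span ℂ {T | ∃ x y, X.theta x y = T} ≤ Y.compacts.comap Φ.toLinearMap := by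
    rw [Submodule.span_le]
    rintro _ ⟨x, y, rfl⟩
    exact h x y
  exact (Y.isClosed_compacts.preimage Φ.continuous).closure_subset_iff.2 h1 hT

theorem conj_mem_compacts {X Y : Corr A B} (f : CorrIso X Y) {T : X.carrier →L[ℂ] X.carrier}
    (hT : T ∈ X.compacts) : f.toCLM.comp (T.comp f.symm.toCLM) ∈ Y.compacts := by
  let Φ : (X.carrier →L[ℂ] X.carrier) →L[ℂ] (Y.carrier →L[ℂ] Y.carrier) :=
    (ContinuousLinearMap.compL ℂ _ _ _ f.toCLM).comp
      ((ContinuousLinearMap.compL ℂ _ _ _).flip f.symm.toCLM)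
  refine map_mem_compacts Φ (fun x y => ?_) hT
  have e : Φ (X.theta x y) = Y.theta (f x) (f y) := by
    ext z
    change f (X.rsmul x (X.inner y (f.symm z))) = Y.rsmul (f x) (Y.inner (f y) z)
    rw [f.map_rsmul, ← f.map_inner, f.apply_symm_apply]
  rw [e]
  exact Y.theta_mem _ _

theorem φ_mem_compacts_of_iso {X Y : Corr A B} (f : CorrIso X Y) {a : A}
    (h : X.φ a ∈ X.compacts) : Y.φ a ∈ Y.compacts := by
  have e : Y.φ a = f.toCLM.comp ((X.φ a).comp f.symm.toCLM) := by
    ext y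
    change Y.lsmul a y = f (X.lsmul a (f.symm y))
    rw [f.map_lsmul, f.apply_symm_apply]
  rw [e]
  exact conj_mem_compacts f h

/-- If `φ_X(a)` is compact and `B` acts on `Y` by compact operators, then `φ_X(a) ⊗ 1` is
compact. -/
theorem φ_tensor_mem_compacts {X : Corr A B} {Y : Corr B C} (hY : ∀ b, Y.φ b ∈ Y.compacts)
    {a : A} (ha : X.φ a ∈ X.compacts) : (X.tensor Y).φ a ∈ (X.tensor Y).compacts := by
  refine (X.tensor Y).isClosed_compacts.closure_subset ?_
  rw [Metric.mem_closure_iff]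
  intro ε hε
  obtain ⟨F, hF, hFa⟩ := Metric.mem_closure_iff.1
    (show X.φ a ∈ closure (Submodule.span ℂ {T | ∃ x y, X.theta x y = T} : Set _) from ha) ε hε
  obtain ⟨⟨F', hF'⟩, R, hR, hR'⟩ := exists_span_tensor (Y := Y) hY hF
  refine ⟨R, hR, ?_⟩
  rw [dist_eq_norm] at hFa ⊢
  refine lt_of_le_of_lt (norm_le_of_tmul X Y (S := X.φ a - F) (S' := X.φ (star a) - F')
    (fun x y => ?_) _ (fun x y => ?_)) hFa
  · change X.inner (X.lsmul a x - F x) y = X.inner x (X.lsmul (star a) y - F' y)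
    rw [inner_sub_left, inner_sub_right, hF', X.inner_lsmul_left]
  · change (X.tensor Y).lsmul a (X.tmul Y x y) - R (X.tmul Y x y)
      = X.tmul Y (X.lsmul a x - F x) y
    rw [sub_tmul, hR', lsmul_tmul]

/-- The annihilation operator `X.ann Y x` is the adjoint of `y ↦ x ⊗ y`. -/
theorem inner_ann {X : Corr A B} {Y : Corr B C} (x : X.carrier) (y : Y.carrier)
    (t : (X.tensor Y).carrier) : Y.inner y (X.ann Y x t) = (X.tensor Y).inner (X.tmul Y x y) t :=
  Lin.ext (f := fun t => Y.inner y (X.ann Y x t))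
    (g := fun t => (X.tensor Y).inner (X.tmul Y x y) t)
    ⟨(Y.innerL y).comp (X.ann Y x), fun _ => rfl⟩
    ⟨(X.tensor Y).innerL (X.tmul Y x y), fun _ => rfl⟩
    (fun u v => by rw [ann_tmul, inner_tmul]) t

theorem norm_le_norm_φ_one (a : A) : ‖a‖ ≤ ‖(one A).φ a‖ := by
  have h1 : ‖a * star a‖ ≤ ‖(one A).φ a‖ * ‖star a‖ := ((one A).φ a).le_opNorm (star a : A)
  rw [CStarRing.norm_self_mul_star, norm_star] at h1
  rcases (norm_nonneg a).eq_or_lt with h0 | h0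
  · rw [← h0]; positivity
  · exact le_of_mul_le_mul_right h1 h0

/-- Every compact operator on the Hilbert module `A` is left multiplication by an element
of `A`. -/
theorem exists_φ_one_eq {T : (one A).carrier →L[ℂ] (one A).carrier} (hT : T ∈ (one A).compacts) :
    ∃ a : A, (one A).φ a = T := by
  have hanti : AntilipschitzWith 1 (one A).φL :=
    AddMonoidHomClass.antilipschitz_of_bound _ fun a => by
      rw [NNReal.coe_one, one_mul]; exact norm_le_norm_φ_one a
  have hcl : IsClosed (((one A).φL.toLinearMap.range : Submodule ℂ _) :
      Set ((one A).carrier →L[ℂ] (one A).carrier)) :=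
    hanti.isClosed_range (one A).φL.uniformContinuous
  refine Submodule.topologicalClosure_minimal _ ?_ hcl hT
  rw [Submodule.span_le]
  rintro _ ⟨x, y, rfl⟩
  refine ⟨(show A from x) * star (show A from y), ?_⟩
  ext z
  exact mul_assoc (show A from x) (star (show A from y)) (show A from z)

end Corr

/-! ### Invertible correspondences are imprimitivity bimodules -/

namespace Corr

/-- If `A` acts faithfully on `M` and every rank-one operator `θ_{x,y}` is the action of an element
of `A`, then that element is the value `⟪x, y⟫` of an `A`-valued inner product. -/
theorem exists_leftInner {M : Corr A B} (hM : Function.Injective M.φ)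
    (h : ∀ x y, ∃ a, M.φ a = M.theta x y) :
    ∃ L : LeftInner M, ∀ x y, M.φ (L.linner x y) = M.theta x y := by
  choose f hf using h
  have hf' : ∀ x y z, M.lsmul (f x y) z = M.rsmul x (M.inner y z) := fun x y z =>
    congrArg (fun T : M.carrier →L[ℂ] M.carrier => T z) (hf x y)
  have hstar : ∀ x y, star (f x y) = f y x := fun x y => eq_of_lsmul_eq hM fun z =>
    M.ext_inner fun w => by
      rw [M.inner_lsmul_right, star_star, hf', hf', M.inner_rsmul_left, M.inner_rsmul_right,
        M.star_inner]
  have hnonneg : ∀ x, 0 ≤ f x x := fun x => by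
    obtain ⟨m, R, hm, h1, h2⟩ := exists_negPart (f x x) (hstar x x)
    -- `⟪z, m θ_{x,x} m z⟫` is positive and equals `-⟪R z, R z⟫`, which forces `R = 0`.
    have hR : R = 0 := eq_of_lsmul_eq hM fun z => by
      rw [zero_lsmul]
      refine M.eq_zero_of_inner_self (le_antisymm ?_ (M.inner_self_nonneg _))
      have h3 : M.inner z (M.lsmul (m * f x x * m) z)
          = star (M.inner x (M.lsmul m z)) * M.inner x (M.lsmul m z) := by
        rw [M.mul_lsmul, M.mul_lsmul, hf', M.inner_lsmul_right, hm, M.inner_rsmul_right,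
          M.star_inner]
      have h4 : M.inner z (M.lsmul (m * f x x * m) z) = -M.inner (M.lsmul R z) (M.lsmul R z) := by
        rw [h1, ← neg_one_smul ℂ, M.smul_lsmul, M.inner_smul_right, M.mul_lsmul,
          M.inner_lsmul_right, star_star, neg_one_smul]
      have h5 := star_mul_self_nonneg (M.inner x (M.lsmul m z))
      rw [← h3, h4] at h5
      exact neg_nonneg.1 h5
    obtain ⟨S, hS⟩ := h2 hR
    rw [hS]
    exact star_mul_self_nonneg S
  refine ⟨⟨f, fun x y z => ?_, fun c x y => ?_, fun a x y => ?_, hstar, hnonneg, fun x hx => ?_,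
    hf'⟩, hf⟩
  · exact eq_of_lsmul_eq hM fun w => by rw [M.add_lsmul, hf', hf', hf', M.add_rsmul]
  · exact eq_of_lsmul_eq hM fun w => by rw [M.smul_lsmul, hf', hf', M.smul_rsmul]
  · exact eq_of_lsmul_eq hM fun w => by rw [M.mul_lsmul, hf', hf', M.lsmul_rsmul]
  · have h1 : M.inner x (M.lsmul (f x x) x) = star (M.inner x x) * M.inner x x := by
      rw [hf', M.inner_rsmul_right, M.star_inner]
    rw [hx, zero_lsmul, inner_zero_right] at h1
    exact M.eq_zero_of_inner_self ((CStarRing.star_mul_self_eq_zero_iff _).1 h1.symm)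

/-- If `M ⊗ N ≅ A`, then `θ_{x,y} ⊗ 1` is a compact operator on the Hilbert module `A`, that is,
an element of `A`; faithfulness of `N` removes the factor `⊗ 1`. -/
theorem exists_φ_eq_theta {M : Corr A B} {N : Corr B A} (hN : N.IsRegular)
    (α : CorrIso (M.tensor N) (one A)) (x y : M.carrier) : ∃ a, M.φ a = M.theta x y := by
  obtain ⟨R, hR, hR'⟩ := exists_theta_tensor (X := M) hN.2 x y
  obtain ⟨a, ha⟩ := exists_φ_one_eq (conj_mem_compacts α hR)
  refine ⟨a, ContinuousLinearMap.ext fun v => eq_of_tmul_eq hN.1 fun w => ?_⟩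
  rw [← hR', φ_apply, ← lsmul_tmul]
  have h1 := congrArg (fun T : (one A).carrier →L[ℂ] (one A).carrier => T (α (M.tmul N v w))) ha
  change (one A).lsmul a (α (M.tmul N v w)) = α (R (α.symm (α (M.tmul N v w)))) at h1
  rw [← α.map_lsmul, α.symm_apply_apply] at h1
  exact α.toEquiv.injective h1

theorem norm_φ_le_of_iso {X Y : Corr A B} (f : CorrIso X Y) (a : A) : ‖Y.φ a‖ ≤ ‖X.φ a‖ := by
  refine ContinuousLinearMap.opNorm_le_bound _ (norm_nonneg _) fun y => ?_
  have h := (X.φ a).le_opNorm (f.symm y)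
  rw [f.symm.norm_map, φ_apply, ← f.norm_map, f.map_lsmul, f.apply_symm_apply] at h
  exact h

/-- If `M ⊗ N ≅ A`, then `φ_M` is bounded below: `‖a‖ = ‖φ_M(a) ⊗ 1‖ ≤ ‖φ_M(a)‖`. -/
theorem norm_le_norm_φ {M : Corr A B} {N : Corr B A} (α : CorrIso (M.tensor N) (one A)) (a : A) :
    ‖a‖ ≤ ‖M.φ a‖ :=
  (norm_le_norm_φ_one a).trans <| (norm_φ_le_of_iso α a).trans <|
    norm_le_of_tmul M N (S' := M.φ (star a)) (fun x y => M.inner_lsmul_left a x y) _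
      fun x y => M.lsmul_tmul N a x y

/-- If `N ⊗ M ≅ B`, then `M` is full, because `⟪n ⊗ m, n' ⊗ m'⟫ = ⟪m, ⟪n, n'⟫ m'⟫`. -/
theorem dense_span_inner {M : Corr A B} {N : Corr B A} (β : CorrIso (N.tensor M) (one B)) :
    Dense (Submodule.span ℂ {b | ∃ x y, M.inner x y = b} : Set B) := by
  let S := (Submodule.span ℂ {b | ∃ x y, M.inner x y = b}).topologicalClosure
  have hS : IsClosed (S : Set B) := Submodule.isClosed_topologicalClosure _
  have h1 : ∀ s t, (N.tensor M).inner s t ∈ S := fun s t => by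
    have h2 : Submodule.span ℂ {z | ∃ n m, N.tmul M n m = z} ≤
        S.comap ((N.tensor M).innerL.flip t).toLinearMap := by
      rw [Submodule.span_le]
      rintro _ ⟨n, m, rfl⟩
      change (N.tensor M).inner (N.tmul M n m) t ∈ S
      rw [← inner_ann]
      exact Submodule.le_topologicalClosure _ (Submodule.subset_span ⟨_, _, rfl⟩)
    exact (hS.preimage ((N.tensor M).innerL.flip t).continuous).closure_subset_iff.2 h2
      (N.dense_tmul M s)
  intro b
  refine hS.closure_subset ?_
  rw [Metric.mem_closure_iff]
  intro ε hε
  obtain ⟨e, -, -, h⟩ := exists_approx b hε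
  refine ⟨e * b, ?_, by rwa [dist_eq_norm]⟩
  have h2 : star (star e) * b ∈ S :=
    (congrArg (· ∈ S) (β.symm.map_inner (star e : B) b)).mp (h1 _ _)
  rwa [star_star] at h2

theorem isImprimitivity_of_inverse {M : Corr A B} {N : Corr B A} (hM : M.IsRegular)
    (hN : N.IsRegular) (α : CorrIso (M.tensor N) (one A)) (β : CorrIso (N.tensor M) (one B)) :
    M.IsImprimitivity := by
  obtain ⟨L, hL⟩ := exists_leftInner hM.1 (exists_φ_eq_theta hN α)
  refine ⟨L, fun a => ?_, dense_span_inner β⟩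
  rw [Metric.mem_closure_iff]
  intro ε hε
  obtain ⟨F, hF, hFa⟩ := Metric.mem_closure_iff.1
    (show M.φ a ∈ closure (Submodule.span ℂ {T | ∃ x y, M.theta x y = T} : Set _) from hM.2 a) ε hε
  have h1 : Submodule.span ℂ {T | ∃ x y, M.theta x y = T} ≤
      (Submodule.span ℂ {a | ∃ x y, L.linner x y = a}).map M.φL.toLinearMap := by
    rw [Submodule.span_le]
    rintro _ ⟨x, y, rfl⟩
    exact ⟨L.linner x y, Submodule.subset_span ⟨x, y, rfl⟩, hL x y⟩
  obtain ⟨s, hs, rfl⟩ := h1 hF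
  refine ⟨s, hs, ?_⟩
  rw [dist_eq_norm] at hFa ⊢
  refine (norm_le_norm_φ α (a - s)).trans_lt ?_
  rw [← φL_apply, map_sub]
  exact hFa

end Corr

/-! ### The dual of an imprimitivity bimodule -/

/-- The complex conjugate of a complex normed space: the same additive group, with the scalar
multiplication `c • x` of the original space replaced by `conj c • x`. -/
def ConjSpace (E : Type u) : Type u := E

namespace ConjSpace

variable (E : Type u) [NormedAddCommGroup E] [NormedSpace ℂ E]

instance : NormedAddCommGroup (ConjSpace E) := inferInstanceAs (NormedAddCommGroup E)

instance [CompleteSpace E] : CompleteSpace (ConjSpace E) := inferInstanceAs (CompleteSpace E)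

noncomputable instance : Module ℂ (ConjSpace E) := Module.compHom E (starRingEnd ℂ)

noncomputable instance : NormedSpace ℂ (ConjSpace E) where
  norm_smul_le c x := by
    rw [← Complex.norm_conj c]
    exact norm_smul_le (starRingEnd ℂ c) (show E from x)

end ConjSpace

namespace LeftInner

variable {M : Corr A B} (L : LeftInner M)

theorem add_right (x y z : M.carrier) : L.linner x (y + z) = L.linner x y + L.linner x z := by
  rw [← L.star_linner, L.add_left, star_add, L.star_linner, L.star_linner]

theorem smul_right (c : ℂ) (x y : M.carrier) : L.linner x (c • y) = star c • L.linner x y := by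
  rw [← L.star_linner, L.smul_left, star_smul, L.star_linner]

theorem lsmul_right (a : A) (x y : M.carrier) :
    L.linner x (M.lsmul a y) = L.linner x y * star a := by
  rw [← L.star_linner, L.lsmul_left, star_mul, L.star_linner]

/-- The left inner product is full: its values span a dense subspace of `A`. -/
def Full : Prop := Dense (Submodule.span ℂ {a | ∃ x y, L.linner x y = a} : Set A)

variable {L}

theorem Full.injective_φ (hL : L.Full) : Function.Injective M.φ := by
  refine Corr.injective_φ_of_lsmul_eq_zero fun a ha => ?_
  have h0 : ∀ y, L.linner 0 y = 0 := fun y => by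
    rw [← zero_smul ℂ (0 : M.carrier), L.smul_left, zero_smul]
  have h1 : ContinuousLinearMap.mul ℂ A a = 0 := ContinuousLinearMap.ext_on hL <| by
    rintro _ ⟨x, y, rfl⟩
    change a * L.linner x y = 0
    rw [← L.lsmul_left, ha, h0]
  have h2 : a * star a = 0 := congrArg (fun T : A →L[ℂ] A => T (star a)) h1
  exact (CStarRing.mul_star_self_eq_zero_iff _).1 h2

theorem Full.rsmul_left (hL : L.Full) (x y : M.carrier) (b : B) :
    L.linner (M.rsmul x b) y = L.linner x (M.rsmul y (star b)) :=
  Corr.eq_of_lsmul_eq hL.injective_φ fun z => by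
    rw [L.compat, L.compat, M.rsmul_rsmul, M.inner_rsmul_left, star_star]

/-- The dual bimodule of `M`, as a pre-correspondence. -/
noncomputable def Full.dualPre (hL : L.Full) : Pre B A where
  V := ConjSpace M.carrier
  ip := LinearMap.mk₂'ₛₗ (starRingEnd ℂ) (RingHom.id ℂ)
    (fun x y : ConjSpace M.carrier => L.linner x y)
    (fun x x' y => L.add_left x x' y)
    (fun c x y => L.smul_left (starRingEnd ℂ c) x y)
    (fun x y y' => L.add_right x y y')
    (fun c x y => (L.smul_right (starRingEnd ℂ c) x y).trans (by simp))
  l b := ⟨⟨fun x => M.rsmul x (star b), fun x y => M.add_rsmul x y _⟩,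
    fun c x => M.smul_rsmul (starRingEnd ℂ c) x _⟩
  r a := ⟨⟨fun x => M.lsmul (star a) x, fun x y => M.lsmul_add _ x y⟩,
    fun c x => M.lsmul_smul _ (starRingEnd ℂ c) x⟩
  star_ip x y := L.star_linner x y
  ip_nonneg x := L.nonneg x
  ip_r x y a := (L.lsmul_right _ x y).trans (by rw [star_star]; rfl)
  l_add a b (x : M.carrier) := by
    change M.rsmul x (star (a + b)) = M.rsmul x (star a) + M.rsmul x (star b)
    rw [star_add, M.rsmul_add]
  l_smul c b (x : M.carrier) := by
    change M.rsmul x (star (c • b)) = star c • M.rsmul x (star b)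
    rw [star_smul, M.rsmul_smul]
  l_mul a b (x : M.carrier) := by
    change M.rsmul x (star (a * b)) = M.rsmul (M.rsmul x (star b)) (star a)
    rw [star_mul, M.rsmul_rsmul]
  ip_l b (x y : M.carrier) := by
    change L.linner (M.rsmul x (star b)) y = L.linner x (M.rsmul y (star (star b)))
    rw [hL.rsmul_left]

/-- The two inner products induce the same norm. -/
theorem Full.norm_sq_eq (hL : L.Full) (x : M.carrier) : ‖x‖ ^ 2 = ‖L.linner x x‖ := by
  -- For `a = ⟪x, x⟫_A` and `b = ⟪x, x⟫_B` one has `a x = x b`, hence `b² = ⟪x, a x⟫_B` and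
  -- `a² = ⟪x b, x⟫_A`; the Cauchy-Schwarz inequality gives `‖b‖² ≤ ‖a‖ ‖b‖` and conversely.
  rw [M.norm_sq_eq]
  have hcancel : ∀ s t : ℝ, 0 ≤ s → 0 ≤ t → s ^ 2 ≤ t * s → s ≤ t := fun s t hs ht h => by
    rcases hs.eq_or_lt with h0 | h0
    · rwa [← h0]
    · rw [sq] at h
      exact le_of_mul_le_mul_right h h0
  refine le_antisymm (hcancel _ _ (norm_nonneg _) (norm_nonneg _) ?_)
    (hcancel _ _ (norm_nonneg _) (norm_nonneg _) ?_)
  · have e : M.inner x (M.lsmul (L.linner x x) x) = star (M.inner x x) * M.inner x x := by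
      rw [L.compat, M.inner_rsmul_right, M.star_inner]
    rw [sq, ← CStarRing.norm_star_mul_self, ← e]
    refine (M.norm_inner_le _ _).trans ((mul_le_mul_of_nonneg_left (M.norm_lsmul_le _ _)
      (norm_nonneg _)).trans (le_of_eq ?_))
    rw [← M.norm_sq_eq]
    ring
  · let P := hL.dualPre
    have e : P.ip (P.l (star (M.inner x x)) x) x = L.linner x x * star (L.linner x x) := by
      change L.linner (M.rsmul x (star (star (M.inner x x)))) x = _
      rw [star_star, ← L.compat, L.lsmul_left, L.star_linner]
    have h1 : P.nrm x ^ 2 = ‖L.linner x x‖ := P.nrm_sq x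
    rw [sq, ← CStarRing.norm_self_mul_star, ← e]
    refine (P.norm_ip_le _ _).trans ?_
    have h2 := P.norm_l_le (star (M.inner x x)) x
    rw [norm_star] at h2
    refine (mul_le_mul_of_nonneg_right h2 (P.nrm_nonneg _)).trans (le_of_eq ?_)
    rw [← h1, sq, ← mul_assoc]
    rfl

/-- The dual `B`-`A` correspondence of `M`: the conjugate space of `M` with actions
`b · x = x b*` and `x · a = a* x` and with the `A`-valued inner product of `M`. -/
noncomputable def Full.dual (hL : L.Full) : Corr B A where
  carrier := ConjSpace M.carrier
  rsmul x a := M.lsmul (star a) x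
  inner x y := L.linner x y
  inner_add_right x y z := L.add_right x y z
  inner_smul_right c x y := map_smul (hL.dualPre.ip x) c y
  inner_rsmul_right := hL.dualPre.ip_r
  star_inner x y := L.star_linner x y
  inner_self_nonneg x := L.nonneg x
  norm_sq_eq x := hL.norm_sq_eq x
  lsmul b x := M.rsmul x (star b)
  add_lsmul := hL.dualPre.l_add
  smul_lsmul := hL.dualPre.l_smul
  mul_lsmul := hL.dualPre.l_mul
  inner_lsmul_left := hL.dualPre.ip_l
  nondegenerate x := by
    refine closure_mono ?_ (Corr.mem_closure_rsmul M.toHilbertModule x)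
    rintro _ ⟨b, rfl⟩
    refine Submodule.subset_span ⟨star b, x, ?_⟩
    rw [star_star]

/-- The `B`-valued inner product of `M`, as a left inner product on the dual of `M`. -/
def Full.dualLeftInner (hL : L.Full) : LeftInner hL.dual where
  linner x y := M.inner x y
  add_left x y z := M.inner_add_left x y z
  smul_left c x y := (M.inner_smul_left (starRingEnd ℂ c) x y).trans (by simp)
  lsmul_left b x y := (M.inner_rsmul_left x y (star b)).trans (by rw [star_star])
  star_linner x y := M.star_inner x y
  nonneg x := M.inner_self_nonneg x
  definite x hx := M.eq_zero_of_inner_self hx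
  compat (x y z : M.carrier) := by
    change M.rsmul z (star (M.inner x y)) = M.lsmul (star (L.linner y z)) x
    rw [M.star_inner, L.star_linner, L.compat]

/-- The isomorphism `M ⊗ M* ≅ A`, `x ⊗ y ↦ ⟪x, y⟫_A`. -/
noncomputable def Full.counit (hL : L.Full) : CorrIso (M.tensor hL.dual) (Corr.one A) :=
  have key : ∀ x y u v : M.carrier, (M.tensor hL.dual).inner (M.tmul hL.dual x y)
      (M.tmul hL.dual u v) = star (L.linner x y) * L.linner u v := fun x y u v => by
    refine (Corr.inner_tmul M hL.dual x u y v).trans ?_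
    change L.linner y (M.rsmul v (star (M.inner x u))) = _
    rw [L.star_linner, ← L.lsmul_left, L.compat, hL.rsmul_left]
  Corr.isoOfGen (fun p : M.carrier × hL.dual.carrier => M.tmul hL.dual p.1 p.2)
    (fun p => L.linner p.1 p.2) (Corr.Gen.tmul_id M hL.dual)
    (Dense.mono (Submodule.span_mono (by rintro _ ⟨x, y, rfl⟩; exact ⟨(x, y), rfl⟩)) hL)
    (fun p q => key _ _ _ _)
    (fun a p q => by
      rw [Corr.lsmul_tmul]
      exact (key _ _ _ _).trans (congrArg (star (L.linner p.1 p.2) * ·) (L.lsmul_left _ _ _)))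

/-! ### Regularity and the Katsura ideal -/

theorem Full.isRegular (hL : L.Full) : M.IsRegular := by
  refine ⟨hL.injective_φ, fun a =>
    Corr.mem_of_gen hL M.compacts M.isClosed_compacts M.φL ?_ a⟩
  rintro _ ⟨x, y, rfl⟩
  have e : M.φL (L.linner x y) = M.theta x y := by ext z; exact L.compat x y z
  rw [e]
  exact M.theta_mem x y

/-- The operator `φ_Y(⟪m, a m'⟫)` is the compression of `φ_{M ⊗ Y}(a)` by the creation operators
`y ↦ m ⊗ y` and `y ↦ m' ⊗ y`, and such compressions preserve compactness. -/
theorem φ_inner_mem_compacts {Y : Corr B C} {a : A} (h : (M.tensor Y).φ a ∈ (M.tensor Y).compacts)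
    (m m' : M.carrier) : Y.φ (M.inner m (M.lsmul a m')) ∈ Y.compacts := by
  let Φ : ((M.tensor Y).carrier →L[ℂ] (M.tensor Y).carrier) →L[ℂ] (Y.carrier →L[ℂ] Y.carrier) :=
    (ContinuousLinearMap.compL ℂ _ _ _ (M.ann Y m)).comp
      ((ContinuousLinearMap.compL ℂ _ _ _).flip (M.tmulL Y m'))
  have e : Y.φ (M.inner m (M.lsmul a m')) = Φ ((M.tensor Y).φ a) := by
    ext y
    change _ = M.ann Y m ((M.tensor Y).lsmul a (M.tmul Y m' y))
    rw [Corr.lsmul_tmul, Corr.ann_tmul, Corr.φ_apply]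
  rw [e]
  refine Corr.map_mem_compacts Φ (fun s t => ?_) h
  have e2 : Φ ((M.tensor Y).theta s t) = Y.theta (M.ann Y m s) (M.ann Y m' t) := by
    ext y
    change M.ann Y m ((M.tensor Y).rsmul s ((M.tensor Y).inner t (M.tmul Y m' y)))
      = Y.rsmul (M.ann Y m s) (Y.inner (M.ann Y m' t) y)
    refine Y.ext_inner fun z => ?_
    rw [Corr.inner_ann, HilbertModule.inner_rsmul_right, HilbertModule.inner_rsmul_right,
      Corr.inner_ann, ← Y.star_inner y, Corr.inner_ann, HilbertModule.star_inner]
  rw [e2]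
  exact Y.theta_mem _ _

/-- If `X ⊗ M ≅ M ⊗ Y` for an imprimitivity bimodule `M`, then `⟪M, J_X M⟫ ⊆ J_Y`. -/
theorem Full.inner_mem_katsuraIdeal (hL : L.Full) {X : Corr A A} {Y : Corr B B}
    (U : CorrIso (X.tensor M) (M.tensor Y)) {a : A} (ha : a ∈ X.katsuraIdeal) (m m' : M.carrier) :
    M.inner m (M.lsmul a m') ∈ Y.katsuraIdeal := by
  refine ⟨φ_inner_mem_compacts (Corr.φ_mem_compacts_of_iso U
    (Corr.φ_tensor_mem_compacts hL.isRegular.2 ha.1)) m m', fun c hc => ?_⟩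
  -- For `c ∈ ker φ_Y` the element `⟪m' c, n⟫_A` annihilates `M ⊗ Y ≅ X ⊗ M`, hence `X`.
  have h1 : ∀ n, X.φ (L.linner (M.rsmul m' c) n) = 0 := fun n => by
    have h2 : ∀ t, (M.tensor Y).lsmul (L.linner (M.rsmul m' c) n) t = 0 :=
      Corr.Lin.ext (f := (M.tensor Y).lsmul (L.linner (M.rsmul m' c) n)) (g := fun _ => 0)
        (Corr.Lin.lsmul _) ⟨0, fun _ => rfl⟩ fun u y => by
      have h3 : Y.lsmul c (Y.lsmul (M.inner n u) y) = 0 := by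
        rw [← Corr.φ_apply, hc]; rfl
      rw [Corr.lsmul_tmul, L.compat, M.rsmul_rsmul, Corr.rsmul_tmul_eq, Y.mul_lsmul, h3,
        ← Corr.tmulL_apply, map_zero]
    ext x
    refine Corr.eq_of_tmul_eq hL.injective_φ (v := 0) fun w => U.toEquiv.injective ?_
    rw [Corr.φ_apply, ← Corr.lsmul_tmul, Corr.zero_tmul, map_zero, U.map_lsmul, h2]
  have h4 : M.lsmul a (M.rsmul m' c) = 0 := L.definite _ <| by
    rw [L.lsmul_left]
    exact ha.2 _ (h1 _)
  rw [← M.inner_rsmul_right, ← M.lsmul_rsmul, h4, Corr.inner_zero_right]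

theorem Full.leftSub_le_rightSub (hL : L.Full) {X : Corr A A} {Y : Corr B B}
    (U : CorrIso (X.tensor M) (M.tensor Y)) :
    M.leftSub X.katsuraIdeal ≤ M.rightSub Y.katsuraIdeal := by
  have hcl : IsClosed (M.rightSub Y.katsuraIdeal : Set M.carrier) :=
    Submodule.isClosed_topologicalClosure _
  refine Submodule.topologicalClosure_minimal _ ?_ hcl
  rw [Submodule.span_le]
  rintro _ ⟨a, ha, m, rfl⟩
  -- `⟪x, y⟫_A a m = x ⟪y, a m⟫_B` lies in `M · J_Y`, and these elements approximate `a m`.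
  have h1 : ∀ d, M.lsmul (d * a) m ∈ M.rightSub Y.katsuraIdeal := fun d => by
    rw [M.mul_lsmul]
    refine Corr.mem_of_gen hL _ hcl (M.φL.flip (M.lsmul a m)) ?_ d
    rintro _ ⟨x, y, rfl⟩
    change M.lsmul (L.linner x y) (M.lsmul a m) ∈ _
    rw [L.compat]
    exact Submodule.le_topologicalClosure _
      (Submodule.subset_span ⟨_, hL.inner_mem_katsuraIdeal U ha y m, x, rfl⟩)
  have h2 : a ∈ closure {z | ∃ d, d * a = z} := by
    rw [Metric.mem_closure_iff]
    intro ε hε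
    obtain ⟨e, -, -, h⟩ := Corr.exists_approx a hε
    exact ⟨e * a, ⟨e, rfl⟩, by rwa [dist_eq_norm]⟩
  refine (hcl.preimage (M.φL.flip m).continuous).closure_subset_iff.2 ?_ h2
  rintro _ ⟨d, rfl⟩
  exact h1 d

end LeftInner

/-! ### Inverting an imprimitivity bimodule -/

namespace Corr

variable {M : Corr A B}

/-- If `M` is full on the right, a closed subspace of `K` containing `⟪M, M⟫ · K` is everything. -/
theorem mem_of_inner_lsmul (hM : Dense (Submodule.span ℂ {b | ∃ x y, M.inner x y = b} : Set B))
    {K : Corr B C} {S : Submodule ℂ K.carrier} (hS : IsClosed (S : Set K.carrier))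
    (h : ∀ x y k, K.lsmul (M.inner x y) k ∈ S) (k : K.carrier) : k ∈ S := by
  refine mem_of_gen' K.nondegenerate S hS ?_ k
  rintro _ ⟨b, k, rfl⟩
  refine mem_of_gen hM S hS (K.φL.flip k) ?_ b
  rintro _ ⟨x, y, rfl⟩
  exact h x y k

theorem tmul_ann (L : LeftInner M) {K : Corr B C} (x y : M.carrier) (t : (M.tensor K).carrier) :
    M.tmul K x (M.ann K y t) = (M.tensor K).lsmul (L.linner x y) t :=
  Lin.ext (f := fun t => M.tmul K x (M.ann K y t)) (g := (M.tensor K).lsmul (L.linner x y))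
    (Lin.tmul_right x ⟨M.ann K y, fun _ => rfl⟩) (Lin.lsmul _)
    (fun u k => by rw [ann_tmul, lsmul_tmul, L.compat, rsmul_tmul_eq]) t

theorem inner_ann_ann (L : LeftInner M) {K : Corr B C} (x y : M.carrier)
    (s t : (M.tensor K).carrier) : K.inner (M.ann K x s) (M.ann K y t)
      = (M.tensor K).inner s ((M.tensor K).lsmul (L.linner x y) t) := by
  rw [inner_ann, tmul_ann L, (M.tensor K).inner_lsmul_left, L.star_linner]

theorem lsmul_ann {K : Corr B C} (b : B) (x : M.carrier) (t : (M.tensor K).carrier) :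
    K.lsmul b (M.ann K x t) = M.ann K (M.rsmul x (star b)) t :=
  K.ext_inner fun z => by
    rw [K.inner_lsmul_right, inner_ann, inner_ann, rsmul_tmul_eq]

/-- For an imprimitivity bimodule `M`, every isomorphism `W : M ⊗ K ≅ M ⊗ K'` is of the form
`1 ⊗ V`.  The isomorphism `V` sends `⟪n, m⟫ · k` to the image of `W (m ⊗ k)` under
`u ⊗ v ↦ ⟪n, u⟫ · v`. -/
theorem exists_tensorIso_refl_eq (L : LeftInner M)
    (hM : Dense (Submodule.span ℂ {b | ∃ x y, M.inner x y = b} : Set B)) {K K' : Corr B C}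
    (W : CorrIso (M.tensor K) (M.tensor K')) :
    ∃ V : CorrIso K K', tensorIso (CorrIso.refl M) V = W := by
  let z : M.carrier × M.carrier × K.carrier → K.carrier :=
    fun p => M.ann K p.1 (M.tmul K p.2.1 p.2.2)
  let w : M.carrier × M.carrier × K.carrier → K'.carrier :=
    fun p => M.ann K' p.1 (W (M.tmul K p.2.1 p.2.2))
  have hz : Gen K.toHilbertModule z := fun k =>
    mem_of_inner_lsmul (S := (Submodule.span ℂ (Set.range z)).topologicalClosure) hM
      (Submodule.isClosed_topologicalClosure _) (fun x y k =>
        Submodule.le_topologicalClosure _ (Submodule.subset_span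
          ⟨(x, y, k), M.ann_tmul K x y k⟩)) k
  have hw : Gen K'.toHilbertModule w := by
    let S := (Submodule.span ℂ (Set.range w)).topologicalClosure
    have hS : IsClosed (S : Set K'.carrier) := Submodule.isClosed_topologicalClosure _
    refine fun k => mem_of_inner_lsmul (S := S) hM hS (fun x y k => ?_) k
    have h1 : ∀ t, M.ann K' x (W t) ∈ S :=
      mem_of_gen (M.dense_tmul K) S hS ((M.ann K' x).comp W.toCLM) <| by
        rintro _ ⟨m, k, rfl⟩
        exact Submodule.le_topologicalClosure _ (Submodule.subset_span ⟨(x, m, k), rfl⟩)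
    have h2 := h1 (W.symm (M.tmul K' y k))
    rwa [W.apply_symm_apply, ann_tmul] at h2
  have hin : ∀ p q, K.inner (z p) (z q) = K'.inner (w p) (w q) := fun p q => by
    simp only [z, w]
    rw [inner_ann_ann L, inner_ann_ann L, ← W.map_lsmul, W.map_inner]
  have hl : ∀ b p q, K.inner (z p) (K.lsmul b (z q)) = K'.inner (w p) (K'.lsmul b (w q)) :=
    fun b p q => by
    have h1 := hin p (M.rsmul q.1 (star b), q.2)
    simp only [z, w] at h1 ⊢
    rw [lsmul_ann, lsmul_ann, h1]
  let V := isoOfGen z w hz hw hin hl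
  refine ⟨V, iso_ext fun m k => ?_⟩
  rw [tensorIso_tmul, CorrIso.refl_apply]
  have h1 : (M.tmulL K' m).comp V.toCLM = W.toCLM.comp (M.tmulL K m) := by
    refine clm_ext hz fun p => ?_
    change M.tmul K' m (V (z p)) = W (M.tmul K m (z p))
    rw [show V (z p) = w p from isoOfGen_apply z w hz hw hin hl p]
    simp only [z, w]
    rw [tmul_ann L, tmul_ann L, W.map_lsmul]
  exact congrArg (fun T : K.carrier →L[ℂ] (M.tensor K').carrier => T k) h1

theorem tensorIso_symm_refl {X X' : Corr A B} (Y : Corr B C) (f : CorrIso X X')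
    (t : (X.tensor Y).carrier) :
    tensorIso f.symm (CorrIso.refl Y) (tensorIso f (CorrIso.refl Y) t) = t :=
  Lin.ext (f := fun t => tensorIso f.symm (CorrIso.refl Y) (tensorIso f (CorrIso.refl Y) t))
    (g := fun t => t) (Lin.iso _ (Lin.iso _ Lin.id)) Lin.id
    (fun x y => by
      simp only [tensorIso_tmul, CorrIso.symm_apply_apply, CorrIso.refl_apply]) t

end Corr

open CategoryTheory

namespace ECPair

variable {X Y : ECCor.{u}}

/-- A pair whose correspondence is an imprimitivity bimodule `M` has a right inverse carried by the
dual `M*`.  The required isomorphism `Y ⊗ M* ≅ M* ⊗ X` is the one which becomes, after tensoring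
with `M`, the composite `M ⊗ Y ⊗ M* ≅ X ⊗ M ⊗ M* ≅ X ⊗ A ≅ A ⊗ X ≅ M ⊗ M* ⊗ X`. -/
theorem exists_comp_rel_id (P : ECPair X Y) (hP : P.M.IsImprimitivity) :
    ∃ Q : ECPair Y X, Q.M.IsImprimitivity ∧ (P.comp Q).Rel (ECPair.id X) := by
  obtain ⟨L, hL, hM⟩ := hP
  have hL : L.Full := hL
  let N := hL.dual
  let ε : CorrIso (P.M.tensor N) (Corr.one X.A) := hL.counit
  let W : CorrIso (P.M.tensor (Y.X.tensor N)) (P.M.tensor (N.tensor X.X)) :=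
    (Corr.assoc P.M Y.X N).symm.trans <| (Corr.tensorIso P.U.symm (CorrIso.refl N)).trans <|
      (Corr.assoc X.X P.M N).trans <| (Corr.tensorIso (CorrIso.refl X.X) ε).trans <|
        (Corr.unitU X.X).trans <| (Corr.tensorIso ε (CorrIso.refl X.X)).symm.trans <|
          Corr.assoc P.M N X.X
  obtain ⟨V, hV⟩ := Corr.exists_tensorIso_refl_eq L hM W
  have hN : hL.dualLeftInner.Full := hM
  have key : ∀ t, Corr.tensorIso ε (CorrIso.refl X.X) (Corr.compU P.U V t)
      = Corr.unitU X.X (Corr.tensorIso (CorrIso.refl X.X) ε t) := fun t => by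
    simp only [Corr.compU, Corr.compR, hV, W, CorrIso.trans_apply, CorrIso.symm_apply_apply,
      CorrIso.apply_symm_apply, Corr.tensorIso_symm_refl]
  refine ⟨⟨N, V, hN.isRegular, hN.leftSub_le_rightSub V⟩, ⟨hL.dualLeftInner, hN, hL⟩,
    ε, CorrIso.ext key⟩

end ECPair

namespace ECCor

variable {X Y : ECCor.{u}}

theorem isIso_homMk (P : ECPair X Y) (hP : P.M.IsImprimitivity) : IsIso (homMk P) := by
  obtain ⟨Q, hQ, hPQ⟩ := P.exists_comp_rel_id hP
  obtain ⟨R, -, hQR⟩ := Q.exists_comp_rel_id hQ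
  have h1 : homMk P ≫ homMk Q = 𝟙 X := Quotient.sound hPQ
  have h2 : homMk Q ≫ homMk R = 𝟙 Y := Quotient.sound hQR
  have h3 : homMk P = homMk R := by
    rw [← Category.comp_id (homMk P), ← h2, ← Category.assoc, h1, Category.id_comp]
  exact ⟨homMk Q, h1, by rw [h3, h2]⟩

theorem isImprimitivity_of_isIso (P : ECPair X Y) [IsIso (homMk P)] : P.M.IsImprimitivity := by
  obtain ⟨Q, hQ⟩ := Quotient.exists_rep (inv (homMk P))
  have h1 : homMk P ≫ homMk Q = 𝟙 X := by
    rw [show homMk Q = inv (homMk P) from hQ, IsIso.hom_inv_id]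
  have h2 : homMk Q ≫ homMk P = 𝟙 Y := by
    rw [show homMk Q = inv (homMk P) from hQ, IsIso.inv_hom_id]
  obtain ⟨α, -⟩ : (P.comp Q).Rel (ECPair.id X) := Quotient.exact h1
  obtain ⟨β, -⟩ : (Q.comp P).Rel (ECPair.id Y) := Quotient.exact h2
  exact Corr.isImprimitivity_of_inverse P.regular Q.regular α β

end ECCor

end CStarCorr

theorem mainTheorem6 :
    (∀ (X Y : CStarCorr.ECCor.{u}) (P : CStarCorr.ECPair X Y),
      CategoryTheory.IsIso (CStarCorr.ECCor.homMk P) ↔ P.M.IsImprimitivity) ∧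
    (∀ X Y : CStarCorr.ECCor.{u},
      Nonempty (CategoryTheory.Iso X Y) ↔ CStarCorr.MoritaEquivalent X.X Y.X) := by
  refine ⟨fun X Y P => ⟨fun _ => CStarCorr.ECCor.isImprimitivity_of_isIso P,
    CStarCorr.ECCor.isIso_homMk P⟩, fun X Y => ⟨fun ⟨f⟩ => ?_, fun ⟨M, hM, ⟨U⟩⟩ => ?_⟩⟩
  · obtain ⟨P, hP⟩ := Quotient.exists_rep f.hom
    have : CategoryTheory.IsIso (CStarCorr.ECCor.homMk P) :=
      (show CStarCorr.ECCor.homMk P = f.hom from hP) ▸ inferInstance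
    exact ⟨P.M, CStarCorr.ECCor.isImprimitivity_of_isIso P, ⟨P.U⟩⟩
  · obtain ⟨L, hL, hB⟩ := hM
    have hL : L.Full := hL
    have := CStarCorr.ECCor.isIso_homMk
      (⟨M, U, hL.isRegular, hL.leftSub_le_rightSub U⟩ : CStarCorr.ECPair X Y) ⟨L, hL, hB⟩
    exact ⟨CategoryTheory.asIso (CStarCorr.ECCor.homMk
      (⟨M, U, hL.isRegular, hL.leftSub_le_rightSub U⟩ : CStarCorr.ECPair X Y))⟩
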